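/- Let $s\ge 2$ be an integer and let $\lambda_s=\dfrac{\Gamma(1/s)^s}{s^s\,s!}$. A sequence of pseudo $s$-th powers is a random set $A$ of positive integers for which the events $\{n\in A\}$, $n\ge 1$, are independent and $\mathbb P(n\in A)=\frac1s n^{-1+1/s}$. For a fixed (deterministic) set $B$ of non-negative integers write $B(n)=|B\cap[1,n]|$; say that $B$ is at the threshold if $$\liminf_{n\to\infty}\frac{B(n)}{\log n}=\frac1{\lambda_s}.$$ Call an integer $n$ representable if $n=a_1+\cdots+a_s+b$ with distinct $a_1,\dots,a_s\in A$ and with $b\in B$. (1) There are sets $B$ with $$B(n)=\left\lfloor \lambda_s^{-1}\log n+2\lambda_s^{-1}\log\log n\right\rfloor\quad\text{for all large enough } n,$$ and every such $B$ is at the threshold and has the following property: almost surely, every large enough integer $n$ is representable. (2) Let $t$ be any real function on the positive integers with $t(n)=o(\log n)$ and $(\log n)^3=O\big(e^{\lambda_s t(n)}\big)$. Every set $B$ with $$B(n)=\left\lfloor \lambda_s^{-1}\log n-t(n)\right\rfloor\quad\text{for all large enough } n$$ is at the threshold and has the following property: almost surely, infinitely many positive integers $n$ are not representable. (3) In particular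 this holds for $t(n)=4\lambda_s^{-1}\log\log n$, and for this $t$ there are sets $B$ with $B(n)=\left\lfloor \lambda_s^{-1}\log n-t(n)\right\rfloor$ for all large enough $n$. -/

import Mathlib

open MeasureTheory ProbabilityTheory Filter Asymptotics
open scoped Nat

/-- The constant `λ_s = Γ(1/s)^s / (s^s s!)`. -/
noncomputable def lambdaConst (s : ℕ) : ℝ :=
  Real.Gamma (1 / (s : ℝ)) ^ s / ((s : ℝ) ^ s * (s ! : ℝ))

/-- `A` is a random sequence of pseudo `s`-th powers on the probability space `(Ω, P)`: a random
set of positive integers such that the events `{n ∈ A}` are independent and, for `n ≥ 1`,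
`{n ∈ A}` has probability `n^(-1 + 1/s) / s`. -/
structure IsPseudoPowers {Ω : Type*} [MeasurableSpace Ω] (s : ℕ) (P : Measure Ω)
    (A : Ω → Set ℕ) : Prop where
  zero_notMem : ∀ ω, 0 ∉ A ω
  measurableSet_mem : ∀ n : ℕ, MeasurableSet {ω | n ∈ A ω}
  indep : iIndepSet (fun n : ℕ => {ω | n ∈ A ω}) P
  prob_mem : ∀ n : ℕ, 1 ≤ n →
    P {ω | n ∈ A ω} = ENNReal.ofReal ((n : ℝ) ^ (-1 + 1 / (s : ℝ)) / (s : ℝ))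

/-- The counting function `B(n) = |B ∩ [1, n]|`. -/
noncomputable def countingFn (B : Set ℕ) (n : ℕ) : ℕ := (B ∩ Set.Icc 1 n).ncard

/-- `B(n) = ⌊f(n)⌋` for all large enough `n`. -/
def HasCountingFn (B : Set ℕ) (f : ℕ → ℝ) : Prop :=
  ∀ᶠ n : ℕ in atTop, (countingFn B n : ℤ) = ⌊f n⌋

/-- `liminf B(n) / log n = 1 / λ_s`, the liminf being taken in the extended reals. -/
def AtThreshold (s : ℕ) (B : Set ℕ) : Prop :=
  liminf (fun n : ℕ => (((countingFn B n : ℝ) / Real.log n : ℝ) : EReal)) atTop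
    = (((lambdaConst s)⁻¹ : ℝ) : EReal)

/-- `n = a_1 + ⋯ + a_s + b` with distinct `a_i ∈ A` and with `b ∈ B`. -/
def IsRepresentable (s : ℕ) (A B : Set ℕ) (n : ℕ) : Prop :=
  ∃ (a : Fin s → ℕ) (b : ℕ), Function.Injective a ∧ (∀ i, a i ∈ A) ∧ b ∈ B ∧ n = (∑ i, a i) + b

/-- Almost surely, every large enough integer is representable. -/
def AlmostSurelyComplement {Ω : Type*} [MeasurableSpace Ω] (s : ℕ) (P : Measure Ω)
    (A : Ω → Set ℕ) (B : Set ℕ) : Prop :=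
  ∀ᵐ ω ∂P, ∀ᶠ n : ℕ in atTop, IsRepresentable s (A ω) B n

/-- Almost surely, infinitely many positive integers are not representable. -/
def AlmostSurelyNotComplement {Ω : Type*} [MeasurableSpace Ω] (s : ℕ) (P : Measure Ω)
    (A : Ω → Set ℕ) (B : Set ℕ) : Prop :=
  ∀ᵐ ω ∂P, {n : ℕ | ¬ IsRepresentable s (A ω) B n}.Infinite

/-! Fix a finite set `M` of integers `≥ L`. The number of `s`-subsets of `A` whose sum lies in `M`
is nearly Poisson with mean `λ_s |M|`, so the probability that there is none is `exp(-λ_s |M| ± C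
|M|² (L+1)^(-1/(2s)))`. This is `IsPseudoPowers.exists_measureReal_avoidEvent_bounds`, and both
halves of the theorem rest on it, because `n` fails to be representable exactly when no such subset
has its sum in `n - B`. The lower bound is Harris' inequality, the upper bound Janson's. They need
two inputs.

The mean: the series `∑ P(n ∈ A) X^n` is close to `(Γ(1/s)/s) (1-X)^(-1/s)`, whose `s`-th power has
all its coefficients equal to `(Γ(1/s)/s)^s = s! λ_s`. Passing from ordered tuples to sets costs the
factor `s!` and a diagonal term of smaller order (`exists_abs_sumWeight_sub_le`).

The correlations: splitting a pair of overlapping sets into its intersection and two differences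
bounds the Janson sum by convolutions of powers (`exists_sum_pairs_powerProb_le`).

For the first example, keep only the `b ≤ n/2`. With `h = n/2` rounded down, `n` fails with
probability `O(1/(h log² h))`, which is summable, and Borel–Cantelli concludes.

For sparser `B`, consider the `n ∈ [N, 2N]` for which all of `n - B` is at least `√N`. Each fails
with probability at least a constant times `log³ N / N`, so the expected number of failures is at
least of order `log³ N`. When `n - B` and `n' - B` are disjoint the two failures are almost
independent, and each `n` has only `O(log² N)` exceptional partners. By the second moment method the
probability of no failure tends to `0`. -/

/-! ### Harris, Janson and second moment inequalities for independent random sets -/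

section RandomSet

/-- The event that the finite set `S` is contained in the random set `A`. -/
def hitEvent {Ω : Type*} (A : Ω → Set ℕ) (S : Finset ℕ) : Set Ω := {ω | (S : Set ℕ) ⊆ A ω}

/-- The event that no member of `F` is contained in the random set `A`. -/
def avoidEvent {Ω : Type*} (A : Ω → Set ℕ) (F : Finset (Finset ℕ)) : Set Ω :=
  {ω | ∀ S ∈ F, ¬ (S : Set ℕ) ⊆ A ω}

variable {Ω : Type*}

theorem hitEvent_eq_biInter (A : Ω → Set ℕ) (S : Finset ℕ) :
    hitEvent A S = ⋂ a ∈ S, {ω | a ∈ A ω} := by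
  ext ω
  simp [hitEvent, Set.subset_def]

theorem avoidEvent_eq_biInter (A : Ω → Set ℕ) (F : Finset (Finset ℕ)) :
    avoidEvent A F = ⋂ S ∈ F, (hitEvent A S)ᶜ := by
  ext ω
  simp [hitEvent, avoidEvent]

theorem hitEvent_inter_hitEvent (A : Ω → Set ℕ) (S T : Finset ℕ) :
    hitEvent A S ∩ hitEvent A T = hitEvent A (S ∪ T) := by
  ext ω
  simp [hitEvent]

theorem avoidEvent_insert (A : Ω → Set ℕ) (S : Finset ℕ) (F : Finset (Finset ℕ)) :
    avoidEvent A (insert S F) = avoidEvent A F \ hitEvent A S := by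
  ext ω
  simp [hitEvent, avoidEvent, and_comm]

theorem avoidEvent_union (A : Ω → Set ℕ) (F G : Finset (Finset ℕ)) :
    avoidEvent A (F ∪ G) = avoidEvent A F ∩ avoidEvent A G := by
  ext ω
  simp only [avoidEvent, Finset.mem_union, Set.mem_ofPred_eq, Set.mem_inter_iff]
  exact ⟨fun h => ⟨fun S hS => h S (.inl hS), fun S hS => h S (.inr hS)⟩,
    fun h S hS => hS.elim (h.1 S) (h.2 S)⟩

theorem avoidEvent_anti (A : Ω → Set ℕ) {F G : Finset (Finset ℕ)} (h : F ⊆ G) :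
    avoidEvent A G ⊆ avoidEvent A F := fun _ hω S hS => hω S (h hS)

variable [MeasurableSpace Ω] {P : Measure Ω} {A : Ω → Set ℕ}

theorem measurableSet_hitEvent (hm : ∀ n, MeasurableSet {ω | n ∈ A ω}) (S : Finset ℕ) :
    MeasurableSet (hitEvent A S) := by
  rw [hitEvent_eq_biInter]
  exact Finset.measurableSet_biInter _ fun a _ => hm a

theorem measurableSet_avoidEvent (hm : ∀ n, MeasurableSet {ω | n ∈ A ω})
    (F : Finset (Finset ℕ)) : MeasurableSet (avoidEvent A F) := by
  rw [avoidEvent_eq_biInter]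
  exact Finset.measurableSet_biInter _ fun S _ => (measurableSet_hitEvent hm S).compl

theorem measureReal_hitEvent (hi : iIndepSet (fun n : ℕ => {ω | n ∈ A ω}) P) (S : Finset ℕ) :
    P.real (hitEvent A S) = ∏ a ∈ S, P.real {ω | a ∈ A ω} := by
  rw [hitEvent_eq_biInter, Measure.real, hi.meas_biInter, ENNReal.toReal_prod]
  rfl

/-- The two events are determined by the membership of disjoint sets of integers, hence lie in
independent σ-algebras. -/
theorem measureReal_hitEvent_inter_avoidEvent_of_disjoint
    (hm : ∀ n, MeasurableSet {ω | n ∈ A ω})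
    (hi : iIndepSet (fun n : ℕ => {ω | n ∈ A ω}) P) {S : Finset ℕ} {F : Finset (Finset ℕ)}
    (h : ∀ T ∈ F, Disjoint S T) :
    P.real (hitEvent A S ∩ avoidEvent A F) = P.real (hitEvent A S) * P.real (avoidEvent A F) := by
  have key := hi.indep_generateFrom_of_disjoint hm (S : Set ℕ) (F.biUnion id : Finset ℕ)
    (by
      rw [Finset.disjoint_coe, Finset.disjoint_biUnion_right]
      exact h)
  have h1 : ∀ (U : Set ℕ) (T : Finset ℕ), (T : Set ℕ) ⊆ U →
      MeasurableSet[MeasurableSpace.generateFrom {t | ∃ n ∈ U, {ω | n ∈ A ω} = t}]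
        (hitEvent A T) := by
    intro U T hT
    rw [hitEvent_eq_biInter]
    exact Finset.measurableSet_biInter _ fun a ha =>
      MeasurableSpace.measurableSet_generateFrom ⟨a, hT ha, rfl⟩
  have h2 : MeasurableSet[MeasurableSpace.generateFrom
      {t | ∃ n ∈ ((F.biUnion id : Finset ℕ) : Set ℕ), {ω | n ∈ A ω} = t}] (avoidEvent A F) := by
    rw [avoidEvent_eq_biInter]
    refine Finset.measurableSet_biInter _ fun T hT => MeasurableSet.compl ?_
    refine h1 _ T ?_
    exact_mod_cast Finset.subset_biUnion_of_mem id hT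
  have := (Indep_iff _ _ P).1 key _ _ (h1 _ S subset_rfl) h2
  simp only [Measure.real, this, ENNReal.toReal_mul]

variable [IsProbabilityMeasure P]

/-- Harris' inequality for a principal increasing event and an avoidance event. -/
theorem measureReal_hitEvent_inter_avoidEvent_le
    (hm : ∀ n, MeasurableSet {ω | n ∈ A ω})
    (hi : iIndepSet (fun n : ℕ => {ω | n ∈ A ω}) P) (S : Finset ℕ) (F : Finset (Finset ℕ)) :
    P.real (hitEvent A S ∩ avoidEvent A F) ≤ P.real (hitEvent A S) * P.real (avoidEvent A F) := by
  -- Once `S ⊆ A`, containing `T` amounts to containing `T \ S`. The sets `T \ S` are disjoint from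
  -- `S`, so avoiding them is independent of hitting `S`, and avoiding them is harder than avoiding
  -- the `T`.
  have h1 : hitEvent A S ∩ avoidEvent A F
      ⊆ hitEvent A S ∩ avoidEvent A (F.image (· \ S)) := by
    rintro ω ⟨hS, hF⟩
    refine ⟨hS, fun T hT hTA => ?_⟩
    obtain ⟨T, hTF, rfl⟩ := Finset.mem_image.1 hT
    refine hF T hTF fun a ha => ?_
    by_cases haS : a ∈ S
    · exact hS haS
    · exact hTA (by simpa using ⟨ha, haS⟩)
  have h2 : avoidEvent A (F.image (· \ S)) ⊆ avoidEvent A F := by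
    intro ω hω T hT hTA
    refine hω (T \ S) (Finset.mem_image_of_mem _ hT) fun a ha => hTA ?_
    simp only [Finset.coe_sdiff] at ha
    exact ha.1
  calc P.real (hitEvent A S ∩ avoidEvent A F)
      ≤ P.real (hitEvent A S ∩ avoidEvent A (F.image (· \ S))) := measureReal_mono h1
    _ = P.real (hitEvent A S) * P.real (avoidEvent A (F.image (· \ S))) := by
        refine measureReal_hitEvent_inter_avoidEvent_of_disjoint hm hi fun T hT => ?_
        obtain ⟨T, hT, rfl⟩ := Finset.mem_image.1 hT
        exact Finset.disjoint_sdiff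
    _ ≤ _ := mul_le_mul_of_nonneg_left (measureReal_mono h2) measureReal_nonneg

/-- By Harris, adding `S` to the family removes at most the proportion `P(S ⊆ A)` of the avoidance
event. -/
theorem prod_one_sub_le_measureReal_avoidEvent
    (hm : ∀ n, MeasurableSet {ω | n ∈ A ω})
    (hi : iIndepSet (fun n : ℕ => {ω | n ∈ A ω}) P) (F : Finset (Finset ℕ)) :
    ∏ S ∈ F, (1 - P.real (hitEvent A S)) ≤ P.real (avoidEvent A F) := by
  classical
  induction F using Finset.induction_on with
  | empty => simp [avoidEvent]
  | insert S F hS ih =>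
    rw [Finset.prod_insert hS, avoidEvent_insert]
    have h1 := measureReal_hitEvent_inter_avoidEvent_le hm hi S F
    have h2 := measureReal_inter_add_sdiff (μ := P) (s := avoidEvent A F)
      (measurableSet_hitEvent hm S)
    rw [Set.inter_comm] at h2
    have h3 : P.real (hitEvent A S) ≤ 1 := measureReal_le_one
    have h4 := mul_le_mul_of_nonneg_left ih (sub_nonneg.2 h3)
    linarith

/-- The sum of the probabilities of the pairwise intersections over the ordered pairs of distinct
intersecting members of `F`. -/
noncomputable def janson (P : Measure Ω) (A : Ω → Set ℕ) (F : Finset (Finset ℕ)) : ℝ :=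
  ∑ S ∈ F, ∑ T ∈ F, if S ≠ T ∧ ¬ Disjoint S T then P.real (hitEvent A (S ∪ T)) else 0

/-- Janson's inequality. -/
theorem measureReal_avoidEvent_le_exp
    (hm : ∀ n, MeasurableSet {ω | n ∈ A ω})
    (hi : iIndepSet (fun n : ℕ => {ω | n ∈ A ω}) P) (F : Finset (Finset ℕ)) :
    P.real (avoidEvent A F) ≤ Real.exp (-∑ S ∈ F, P.real (hitEvent A S) + janson P A F) := by
  classical
  induction F using Finset.induction_on with
  | empty => simp [avoidEvent, janson]
  | insert S F hS ih =>
    -- `G` is the part of `F` independent of `S`. The sets of `F` that meet `S` are restored by a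
    -- union bound, each term of which Harris bounds by `P(S ∪ T ⊆ A)` times the probability of
    -- avoiding `G`.
    set G := F.filter fun T => Disjoint S T with hG
    set d := ∑ T ∈ F, if S ≠ T ∧ ¬ Disjoint S T then P.real (hitEvent A (S ∪ T)) else 0 with hd
    have hd' : d = ∑ T ∈ F with ¬ Disjoint S T, P.real (hitEvent A (S ∪ T)) := by
      rw [hd, Finset.sum_filter]
      refine Finset.sum_congr rfl fun T hT => ?_
      have : S ≠ T := fun h => hS (h ▸ hT)
      simp [this]
    -- Ordered pairs count each overlap twice. The row of `S` suffices here and its column is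
    -- dropped.
    have hJ : d + janson P A F ≤ janson P A (insert S F) := by
      unfold janson
      rw [Finset.sum_insert hS]
      refine add_le_add ?_ (Finset.sum_le_sum fun T _ => ?_)
      · rw [Finset.sum_insert hS]
        simp [hd]
      · rw [Finset.sum_insert hS]
        refine le_add_of_nonneg_left ?_
        split_ifs <;> positivity
    have h1 : hitEvent A S ∩ avoidEvent A G ⊆ (hitEvent A S ∩ avoidEvent A F) ∪
        ⋃ T ∈ F.filter fun T => ¬ Disjoint S T, hitEvent A (S ∪ T) ∩ avoidEvent A G := by
      rintro ω ⟨h1, h2⟩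
      by_cases hω : ω ∈ avoidEvent A F
      · exact .inl ⟨h1, hω⟩
      · right
        simp only [avoidEvent, Set.mem_ofPred_eq, not_forall, not_not] at hω
        obtain ⟨T, hT, hTA⟩ := hω
        simp only [Set.mem_iUnion]
        refine ⟨T, Finset.mem_filter.2 ⟨hT, fun hd => ?_⟩, ?_, h2⟩
        · exact h2 T (Finset.mem_filter.2 ⟨hT, hd⟩) hTA
        · rw [← hitEvent_inter_hitEvent]
          exact ⟨h1, hTA⟩
    have h2 : P.real (hitEvent A S ∩ avoidEvent A G) ≤ P.real (hitEvent A S ∩ avoidEvent A F) +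
        d * P.real (avoidEvent A G) := by
      refine (measureReal_mono h1).trans ((measureReal_union_le _ _).trans ?_)
      refine add_le_add le_rfl ((measureReal_biUnion_finset_le _ _).trans ?_)
      rw [hd', Finset.sum_mul]
      exact Finset.sum_le_sum fun T _ => measureReal_hitEvent_inter_avoidEvent_le hm hi _ _
    rw [measureReal_hitEvent_inter_avoidEvent_of_disjoint hm hi
      (fun T hT => (Finset.mem_filter.1 hT).2)] at h2
    have h3 : P.real (avoidEvent A F) ≤ P.real (avoidEvent A G) :=
      measureReal_mono (avoidEvent_anti A (Finset.filter_subset _ _))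
    -- If the first factor is negative the bound is trivial, so nothing has to be assumed about the
    -- size of `d`.
    have h4 : (P.real (hitEvent A S) - d) * P.real (avoidEvent A F)
        ≤ P.real (hitEvent A S ∩ avoidEvent A F) := by
      rcases le_total 0 (P.real (hitEvent A S) - d) with h | h
      · have := mul_le_mul_of_nonneg_left h3 h
        linarith
      · exact (mul_nonpos_of_nonpos_of_nonneg h measureReal_nonneg).trans measureReal_nonneg
    have h5 := measureReal_inter_add_sdiff (μ := P) (s := avoidEvent A F)
      (measurableSet_hitEvent hm S)
    rw [Set.inter_comm] at h5
    rw [avoidEvent_insert, Finset.sum_insert hS]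
    calc P.real (avoidEvent A F \ hitEvent A S)
        ≤ (-P.real (hitEvent A S) + d + 1) * P.real (avoidEvent A F) := by linarith
      _ ≤ Real.exp (-P.real (hitEvent A S) + d) *
          Real.exp (-∑ S ∈ F, P.real (hitEvent A S) + janson P A F) :=
          mul_le_mul (Real.add_one_le_exp _) ih measureReal_nonneg (Real.exp_pos _).le
      _ ≤ _ := by
          rw [← Real.exp_add]
          refine Real.exp_le_exp.2 ?_
          linarith

/-- The second moment bound for the probability that none of finitely many events occurs. -/
theorem measureReal_biInter_compl_mul_sq_le {ι : Type*} (T : Finset ι) (E : ι → Set Ω)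
    (hE : ∀ i, MeasurableSet (E i)) :
    P.real (⋂ i ∈ T, (E i)ᶜ) * (∑ i ∈ T, P.real (E i)) ^ 2 ≤
      ∑ i ∈ T, ∑ j ∈ T, P.real (E i ∩ E j) - (∑ i ∈ T, P.real (E i)) ^ 2 := by
  set m := ∑ i ∈ T, P.real (E i) with hm
  set X : Ω → ℝ := fun ω => ∑ i ∈ T, (E i).indicator 1 ω with hX
  have hint : ∀ F : Set Ω, MeasurableSet F → Integrable (F.indicator (1 : Ω → ℝ)) P :=
    fun F hF => (integrable_const (1 : ℝ)).indicator hF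
  have hXi : Integrable X P := integrable_finsetSum _ fun i _ => hint _ (hE i)
  have hX2 : (fun ω => X ω ^ 2) =
      fun ω => ∑ i ∈ T, ∑ j ∈ T, (E i ∩ E j).indicator (1 : Ω → ℝ) ω := by
    funext ω
    simp only [hX, sq, Finset.sum_mul_sum, Set.inter_indicator_one, Pi.mul_apply]
  have hX2i : Integrable (fun ω => X ω ^ 2) P := by
    rw [hX2]
    exact integrable_finsetSum _ fun i _ => integrable_finsetSum _ fun j _ =>
      hint _ ((hE i).inter (hE j))
  have e1 : ∫ ω, X ω ∂P = m := by
    rw [hX, integral_finsetSum _ fun i _ => hint _ (hE i)]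
    simp [integral_indicator_one, hE, hm]
  have e2 : ∫ ω, X ω ^ 2 ∂P = ∑ i ∈ T, ∑ j ∈ T, P.real (E i ∩ E j) := by
    rw [hX2, integral_finsetSum _ fun i _ => integrable_finsetSum _ fun j _ =>
      hint _ ((hE i).inter (hE j))]
    refine Finset.sum_congr rfl fun i _ => ?_
    rw [integral_finsetSum _ fun j _ => hint _ ((hE i).inter (hE j))]
    exact Finset.sum_congr rfl fun j _ => integral_indicator_one ((hE i).inter (hE j))
  have hZ : MeasurableSet (⋂ i ∈ T, (E i)ᶜ) :=
    Finset.measurableSet_biInter _ fun i _ => (hE i).compl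
  have e3 : ∫ ω, (X ω - m) ^ 2 ∂P = ∑ i ∈ T, ∑ j ∈ T, P.real (E i ∩ E j) - m ^ 2 := by
    have : (fun ω => (X ω - m) ^ 2) = fun ω => X ω ^ 2 - (2 * m) * X ω + m ^ 2 := by
      funext ω
      ring
    have h' : Integrable (fun ω => X ω ^ 2 - (2 * m) * X ω) P := hX2i.sub (hXi.const_mul _)
    rw [this, integral_add h' (integrable_const _), integral_sub hX2i (hXi.const_mul _), integral_const_mul, e1, e2]
    simp
    ring
  have e4 : ∫ ω, (⋂ i ∈ T, (E i)ᶜ).indicator (fun _ => m ^ 2) ω ∂P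
      = P.real (⋂ i ∈ T, (E i)ᶜ) * m ^ 2 := by
    rw [integral_indicator_const _ hZ, smul_eq_mul]
  rw [← e3, ← e4]
  -- When no event occurs the count `X` vanishes, so `(X - m)²` equals `m²` there; elsewhere it is
  -- nonnegative.
  refine integral_mono ((integrable_const _).indicator hZ) ?_ fun ω => ?_
  · have : (fun ω => (X ω - m) ^ 2) = fun ω => X ω ^ 2 - (2 * m) * X ω + m ^ 2 := by
      funext ω
      ring
    rw [this]
    exact (hX2i.sub (hXi.const_mul _)).add (integrable_const _)
  · by_cases hω : ω ∈ ⋂ i ∈ T, (E i)ᶜ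
    · have : X ω = 0 := by
        refine Finset.sum_eq_zero fun i hi => ?_
        simp only [Set.mem_iInter] at hω
        exact Set.indicator_of_notMem (hω i hi) _
      simp [hω, this]
    · simp only [Set.indicator_of_notMem hω]
      positivity

end RandomSet

/-! ### Coefficientwise inequalities between power series -/

section CoeffLE

/-- Coefficientwise comparison of real power series. -/
def CoeffLE (f g : PowerSeries ℝ) : Prop := ∀ n, PowerSeries.coeff n f ≤ PowerSeries.coeff n g

theorem CoeffLE.refl (f : PowerSeries ℝ) : CoeffLE f f := fun _ => le_rfl

theorem CoeffLE.trans {f g h : PowerSeries ℝ} (h₁ : CoeffLE f g) (h₂ : CoeffLE g h) :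
    CoeffLE f h := fun n => (h₁ n).trans (h₂ n)

theorem CoeffLE.add {f g f' g' : PowerSeries ℝ} (h₁ : CoeffLE f g) (h₂ : CoeffLE f' g') :
    CoeffLE (f + f') (g + g') := fun n => by
  simpa using add_le_add (h₁ n) (h₂ n)

theorem CoeffLE.mul {f g f' g' : PowerSeries ℝ} (h₁ : CoeffLE f g) (h₂ : CoeffLE f' g')
    (hf' : CoeffLE 0 f') (hg : CoeffLE 0 g) : CoeffLE (f * f') (g * g') := fun n => by
  simp only [PowerSeries.coeff_mul]
  exact Finset.sum_le_sum fun x _ =>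
    mul_le_mul (h₁ _) (h₂ _) (by simpa using hf' x.2) (by simpa using hg x.1)

theorem CoeffLE.mul_nonneg {f g : PowerSeries ℝ} (hf : CoeffLE 0 f) (hg : CoeffLE 0 g) :
    CoeffLE 0 (f * g) := by
  simpa using CoeffLE.mul hf hg (CoeffLE.refl 0) hf

theorem CoeffLE.C_nonneg {c : ℝ} (hc : 0 ≤ c) : CoeffLE 0 (PowerSeries.C c) := fun n => by
  rw [PowerSeries.coeff_C]
  split_ifs <;> simp [hc]

theorem CoeffLE.pow_nonneg {f : PowerSeries ℝ} (hf : CoeffLE 0 f) (k : ℕ) :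
    CoeffLE 0 (f ^ k) := by
  induction k with
  | zero => simpa using CoeffLE.C_nonneg zero_le_one
  | succ k ih =>
    rw [pow_succ]
    exact ih.mul_nonneg hf

theorem CoeffLE.pow {f g : PowerSeries ℝ} (hf : CoeffLE 0 f) (h : CoeffLE f g) (k : ℕ) :
    CoeffLE (f ^ k) (g ^ k) := by
  induction k with
  | zero => simpa using CoeffLE.refl 1
  | succ k ih =>
    rw [pow_succ, pow_succ]
    exact ih.mul h hf ((hf.trans h).pow_nonneg k)

theorem CoeffLE.mul_left {f g h : PowerSeries ℝ} (h₁ : CoeffLE f g) (hh : CoeffLE 0 h) :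
    CoeffLE (h * f) (h * g) := fun n => by
  simp only [PowerSeries.coeff_mul]
  exact Finset.sum_le_sum fun x _ => mul_le_mul_of_nonneg_left (h₁ _) (by simpa using hh x.1)

theorem CoeffLE.mul_right {f g h : PowerSeries ℝ} (h₁ : CoeffLE f g) (hh : CoeffLE 0 h) :
    CoeffLE (f * h) (g * h) := by
  rw [mul_comm f, mul_comm g]
  exact h₁.mul_left hh

end CoeffLE

/-! ### The coefficients of `(1 - X)^(-β)` -/

section NegativeBinomial

/-- The power series `(1 - X) ^ (-β)`. -/
noncomputable def negBinomialSeries (β : ℝ) : PowerSeries ℝ :=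
  PowerSeries.mk (Ring.multichoose β)

/-- Substituting `-X` gives the binomial series of exponent `-β`, from which additivity in the
exponent is inherited. -/
theorem negBinomialSeries_eq_rescale (β : ℝ) :
    negBinomialSeries β = PowerSeries.rescale (-1) (PowerSeries.binomialSeries ℝ (-β)) := by
  ext n
  rw [negBinomialSeries, PowerSeries.coeff_mk, PowerSeries.coeff_rescale,
    PowerSeries.binomialSeries_coeff, Ring.choose_neg, Ring.multichoose_eq]
  rcases Nat.even_or_odd n with h | h
  · simp [h.neg_one_pow, Int.negOnePow_even n (by exact_mod_cast h)]
  · simp [h.neg_one_pow, Int.negOnePow_odd n (by exact_mod_cast h)]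

theorem negBinomialSeries_add (β γ : ℝ) :
    negBinomialSeries (β + γ) = negBinomialSeries β * negBinomialSeries γ := by
  rw [negBinomialSeries_eq_rescale, negBinomialSeries_eq_rescale, negBinomialSeries_eq_rescale,
    neg_add, PowerSeries.binomialSeries_add, map_mul]

theorem negBinomialSeries_zero : negBinomialSeries 0 = 1 := by
  rw [negBinomialSeries_eq_rescale]
  simp

theorem negBinomialSeries_natCast_mul (β : ℝ) (k : ℕ) :
    negBinomialSeries (k * β) = negBinomialSeries β ^ k := by
  induction k with
  | zero => simp [negBinomialSeries_zero]
  | succ k ih => rw [Nat.cast_succ, add_mul, one_mul, negBinomialSeries_add, ih, pow_succ]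

theorem coeff_negBinomialSeries_one (n : ℕ) :
    PowerSeries.coeff n (negBinomialSeries 1) = 1 := by
  simp [negBinomialSeries, Ring.multichoose_one]

/-- Both `Γ(n+β)/Γ(β)` and `n!` times the coefficient are the rising factorial `β(β+1)⋯(β+n-1)`. -/
theorem Gamma_nat_add_eq {β : ℝ} (hβ : 0 < β) (n : ℕ) :
    Real.Gamma (n + β) =
      Real.Gamma β * (n ! * PowerSeries.coeff n (negBinomialSeries β)) := by
  have h : ∀ n : ℕ, (n ! : ℝ) * PowerSeries.coeff n (negBinomialSeries β)
      = (ascPochhammer ℝ n).eval β := by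
    intro n
    rw [negBinomialSeries, PowerSeries.coeff_mk, ← Polynomial.ascPochhammer_smeval_eq_eval,
      ← Ring.factorial_nsmul_multichoose_eq_ascPochhammer, nsmul_eq_mul]
  rw [h]
  induction n with
  | zero => simp
  | succ n ih =>
    rw [ascPochhammer_succ_eval, ← mul_assoc, ← ih, Nat.cast_succ,
      show (n : ℝ) + 1 + β = (n + β) + 1 by ring, Real.Gamma_add_one (by positivity)]
    ring

/-- Log-convexity of `Γ` at `n + β`, viewed as a point between `n` and `n + 1`. -/
theorem Gamma_nat_add_le {β : ℝ} (h0 : 0 < β) (h1 : β < 1) {n : ℕ} (hn : n ≠ 0) :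
    Real.Gamma (n + β) ≤ n ! * (n : ℝ) ^ (β - 1) := by
  have hn' : (0 : ℝ) < n := by positivity
  have h := Real.Gamma_mul_add_mul_le_rpow_Gamma_mul_rpow_Gamma (s := n) (t := n + 1)
    (a := 1 - β) (b := β) hn' (by positivity) (by linarith) h0 (by ring)
  have hG : Real.Gamma n = n ! * (n : ℝ)⁻¹ := by
    have := Real.Gamma_add_one hn'.ne'
    rw [Real.Gamma_nat_eq_factorial] at this
    rw [this]
    field_simp
  rw [show (1 - β) * (n : ℝ) + β * (n + 1) = n + β by ring, Real.Gamma_nat_eq_factorial, hG,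
    Real.mul_rpow (by positivity) (by positivity), Real.inv_rpow hn'.le, ← Real.rpow_neg hn'.le]
    at h
  refine h.trans_eq ?_
  rw [mul_right_comm, ← Real.rpow_add (by positivity)]
  simp

/-- Log-convexity again, now at `n + 1`, which lies between `n + β` and `n + β + 1`. -/
theorem le_Gamma_nat_add {β : ℝ} (h0 : 0 < β) (h1 : β < 1) (n : ℕ) :
    n ! * ((n : ℝ) + 1) ^ (β - 1) ≤ Real.Gamma (n + β) := by
  have hnβ : (0 : ℝ) < n + β := by positivity
  have h := Real.Gamma_mul_add_mul_le_rpow_Gamma_mul_rpow_Gamma (s := n + β) (t := n + β + 1)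
    (a := β) (b := 1 - β) hnβ (by positivity) h0 (by linarith) (by ring)
  have hG := Real.Gamma_pos_of_pos hnβ
  rw [show β * ((n : ℝ) + β) + (1 - β) * (n + β + 1) = n + 1 by ring,
    Real.Gamma_nat_eq_factorial, Real.Gamma_add_one hnβ.ne',
    Real.mul_rpow hnβ.le hG.le, mul_left_comm, ← Real.rpow_add hG] at h
  simp only [add_sub_cancel, Real.rpow_one] at h
  calc (n ! : ℝ) * ((n : ℝ) + 1) ^ (β - 1)
      ≤ ((n + β) ^ (1 - β) * Real.Gamma (n + β)) * ((n : ℝ) + β) ^ (β - 1) :=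
        mul_le_mul h (Real.rpow_le_rpow_of_nonpos hnβ (by linarith) (by linarith))
          (by positivity) (by positivity)
    _ = Real.Gamma (n + β) := by
        rw [mul_right_comm, ← Real.rpow_add hnβ]
        simp

/-- Bernoulli's inequality with exponent `1 - β ≤ 1`, applied to `(1 + 1/x)^(1-β)`. -/
theorem rpow_sub_rpow_add_one_le {β x : ℝ} (h0 : 0 < β) (h1 : β < 1) (hx : 1 ≤ x) :
    x ^ (β - 1) - (x + 1) ^ (β - 1) ≤ 2 * (x + 1) ^ (β - 2) := by
  have hx0 : 0 < x := by linarith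
  have h := rpow_one_add_le_one_add_mul_self (s := x⁻¹) (p := 1 - β)
    (by have := inv_pos.2 hx0; linarith) (by linarith) (by linarith)
  have e1 : x ^ (β - 1) = (x + 1) ^ (β - 1) * (1 + x⁻¹) ^ (1 - β) := by
    rw [show 1 + x⁻¹ = (x + 1) / x by field_simp, Real.div_rpow (by positivity) hx0.le,
      ← mul_div_assoc, ← Real.rpow_add (by positivity), show β - 1 = -(1 - β) by ring,
      Real.rpow_neg hx0.le]
    simp
  have e2 : (x + 1) ^ (β - 2) = (x + 1) ^ (β - 1) * (x + 1)⁻¹ := by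
    rw [← Real.rpow_neg_one, ← Real.rpow_add (by positivity)]
    ring_nf
  rw [e1, e2]
  have e3 : (1 - β) * x⁻¹ ≤ 2 * (x + 1)⁻¹ := by
    rw [← div_eq_mul_inv, ← div_eq_mul_inv, div_le_div_iff₀ hx0 (by positivity)]
    nlinarith
  have hp : 0 < (x + 1) ^ (β - 1) := by positivity
  nlinarith

theorem rpow_le_two_mul_rpow_add_one {β x : ℝ} (h0 : -1 ≤ β) (h1 : β ≤ 0) (hx : 1 ≤ x) :
    x ^ β ≤ 2 * (x + 1) ^ β := by
  have hx0 : 0 < x := by linarith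
  have h2 : (2 * x) ^ β ≤ (x + 1) ^ β :=
    Real.rpow_le_rpow_of_nonpos (by linarith) (by linarith) h1
  rw [Real.mul_rpow (by norm_num) hx0.le] at h2
  have h3 : (2 : ℝ) ^ (-1 : ℝ) ≤ 2 ^ β := Real.rpow_le_rpow_of_exponent_le (by norm_num) h0
  rw [Real.rpow_neg_one] at h3
  have h4 : 0 < x ^ β := by positivity
  nlinarith

theorem negBinomialSeries_nonneg {β : ℝ} (h0 : 0 ≤ β) : CoeffLE 0 (negBinomialSeries β) := by
  rcases h0.eq_or_lt with rfl | h0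
  · rw [negBinomialSeries_zero]
    exact CoeffLE.C_nonneg zero_le_one
  · intro n
    have h1 := Gamma_nat_add_eq h0 n
    have h2 : 0 < Real.Gamma (n + β) := Real.Gamma_pos_of_pos (by positivity)
    have h3 := Real.Gamma_pos_of_pos h0
    have h4 : (0 : ℝ) < n ! := by positivity
    rw [h1] at h2
    simpa using (pos_of_mul_pos_right (pos_of_mul_pos_right h2 h3.le) h4.le).le

theorem exists_coeff_negBinomialSeries_le {β : ℝ} (h0 : 0 ≤ β) (h1 : β ≤ 1) :
    ∃ C, 0 ≤ C ∧ ∀ n : ℕ,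
      PowerSeries.coeff n (negBinomialSeries β) ≤ C * ((n : ℝ) + 1) ^ (β - 1) := by
  rcases h0.eq_or_lt with rfl | h0
  · refine ⟨1, zero_le_one, fun n => ?_⟩
    rw [negBinomialSeries_zero, PowerSeries.coeff_one]
    split_ifs with h
    · simp [h]
    · positivity
  rcases h1.eq_or_lt with rfl | h1
  · exact ⟨1, zero_le_one, fun n => by simp [coeff_negBinomialSeries_one]⟩
  have hG := Real.Gamma_pos_of_pos h0
  refine ⟨1 + 2 / Real.Gamma β, by positivity, fun n => ?_⟩
  rcases eq_or_ne n 0 with rfl | hn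
  · simp [negBinomialSeries]
    positivity
  · have h2 := Gamma_nat_add_le h0 h1 hn
    have h4 : (0 : ℝ) < n ! := by positivity
    rw [Gamma_nat_add_eq h0, mul_left_comm] at h2
    have h3 := le_of_mul_le_mul_left h2 h4
    have h5 := rpow_le_two_mul_rpow_add_one (β := β - 1) (x := n) (by linarith) (by linarith)
      (by exact_mod_cast Nat.one_le_iff_ne_zero.2 hn)
    have h6 : 0 < ((n : ℝ) + 1) ^ (β - 1) := by positivity
    rw [add_mul, one_mul, div_mul_eq_mul_div]
    refine le_add_of_nonneg_of_le h6.le ?_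
    rw [le_div_iff₀ hG]
    linarith

end NegativeBinomial

/-! ### Convolutions of powers -/

section Convolution

/-- Replacing the larger base by the smaller bounds each product by `x^(-(u+v)) + y^(-(u+v))`, and
`u + v > 1` makes these summable. -/
theorem exists_sum_rpow_mul_rpow_le_of_nonneg {u v : ℝ} (hu : 0 ≤ u) (hv : 0 ≤ v)
    (huv : 1 < u + v) : ∃ C, 0 ≤ C ∧ ∀ m : ℕ, ∑ x ∈ Finset.HasAntidiagonal.antidiagonal m,
      ((x.1 : ℝ) + 1) ^ (-u) * ((x.2 : ℝ) + 1) ^ (-v) ≤ C := by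
  have hsum : Summable fun n : ℕ => ((n : ℝ) + 1) ^ (-(u + v)) := by
    have := (summable_nat_add_iff 1).2 (Real.summable_nat_rpow (p := -(u + v)) |>.2 (by linarith))
    simpa using this
  set Z := ∑' n : ℕ, ((n : ℝ) + 1) ^ (-(u + v)) with hZ
  have hZ0 : 0 ≤ Z := tsum_nonneg fun n => by positivity
  refine ⟨Z + Z, by positivity, fun m => ?_⟩
  have key : ∀ x y : ℝ, 0 < x → 0 < y →
      x ^ (-u) * y ^ (-v) ≤ x ^ (-(u + v)) + y ^ (-(u + v)) := by
    intro x y hx hy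
    have hx' : 0 < x ^ (-(u + v)) := by positivity
    have hy' : 0 < y ^ (-(u + v)) := by positivity
    rcases le_total x y with h | h
    · have : y ^ (-v) ≤ x ^ (-v) := Real.rpow_le_rpow_of_nonpos hx h (by linarith)
      have h2 : x ^ (-u) * y ^ (-v) ≤ x ^ (-u) * x ^ (-v) := by gcongr
      rw [← Real.rpow_add hx, show -u + -v = -(u + v) by ring] at h2
      linarith
    · have : x ^ (-u) ≤ y ^ (-u) := Real.rpow_le_rpow_of_nonpos hy h (by linarith)
      have h2 : x ^ (-u) * y ^ (-v) ≤ y ^ (-u) * y ^ (-v) := by gcongr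
      rw [← Real.rpow_add hy, show -u + -v = -(u + v) by ring] at h2
      linarith
  have hpart : ∑ i ∈ Finset.range (m + 1), ((i : ℝ) + 1) ^ (-(u + v)) ≤ Z :=
    hsum.sum_le_tsum _ fun i _ => by positivity
  calc _ ≤ ∑ x ∈ Finset.HasAntidiagonal.antidiagonal m,
        (((x.1 : ℝ) + 1) ^ (-(u + v)) + ((x.2 : ℝ) + 1) ^ (-(u + v))) :=
        Finset.sum_le_sum fun x _ => key _ _ (by positivity) (by positivity)
    _ = ∑ i ∈ Finset.range (m + 1), ((i : ℝ) + 1) ^ (-(u + v)) +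
        ∑ i ∈ Finset.range (m + 1), ((i : ℝ) + 1) ^ (-(u + v)) := by
        rw [Finset.sum_add_distrib]
        congr 1
        · exact Finset.Nat.sum_antidiagonal_eq_sum_range_succ
            (fun i _ => ((i : ℝ) + 1) ^ (-(u + v))) m
        · rw [← Finset.Nat.sum_antidiagonal_swap]
          exact Finset.Nat.sum_antidiagonal_eq_sum_range_succ
            (fun i _ => ((i : ℝ) + 1) ^ (-(u + v))) m
    _ ≤ Z + Z := add_le_add hpart hpart

/-- Subadditivity of `x ↦ x^d` distributes the factor `(m+1)^d` over the two bases, lowering `u` or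
`v` by `d`. -/
theorem exists_sum_rpow_mul_rpow_le {u v d : ℝ} (hd : 0 ≤ d) (hd1 : d ≤ 1) (hu : d ≤ u)
    (hv : d ≤ v) (huv : 1 < u + v - d) :
    ∃ C, 0 ≤ C ∧ ∀ m : ℕ, ∑ x ∈ Finset.HasAntidiagonal.antidiagonal m,
      ((x.1 : ℝ) + 1) ^ (-u) * ((x.2 : ℝ) + 1) ^ (-v) ≤ C * ((m : ℝ) + 1) ^ (-d) := by
  obtain ⟨C₁, h₁, H₁⟩ := exists_sum_rpow_mul_rpow_le_of_nonneg (u := u - d) (v := v)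
    (by linarith) (by linarith) (by linarith)
  obtain ⟨C₂, h₂, H₂⟩ := exists_sum_rpow_mul_rpow_le_of_nonneg (u := u) (v := v - d)
    (by linarith) (by linarith) (by linarith)
  refine ⟨C₁ + C₂, by positivity, fun m => ?_⟩
  have hm : (0 : ℝ) < (m : ℝ) + 1 := by positivity
  rw [Real.rpow_neg hm.le, ← div_eq_mul_inv, le_div_iff₀ (by positivity), Finset.sum_mul]
  refine le_trans ?_ (add_le_add (H₁ m) (H₂ m))
  rw [← Finset.sum_add_distrib]
  refine Finset.sum_le_sum fun x hx => ?_
  have hx1 : (0 : ℝ) < (x.1 : ℝ) + 1 := by positivity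
  have hx2 : (0 : ℝ) < (x.2 : ℝ) + 1 := by positivity
  have hsub : ((m : ℝ) + 1) ^ d ≤ ((x.1 : ℝ) + 1) ^ d + ((x.2 : ℝ) + 1) ^ d := by
    refine le_trans (Real.rpow_le_rpow hm.le ?_ hd)
      (Real.rpow_add_le_add_rpow hx1.le hx2.le hd hd1)
    have : ((x.1 + x.2 : ℕ) : ℝ) = m := by exact_mod_cast Finset.HasAntidiagonal.mem_antidiagonal.1 hx
    push_cast at this
    linarith
  calc _ ≤ ((x.1 : ℝ) + 1) ^ (-u) * ((x.2 : ℝ) + 1) ^ (-v) *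
        (((x.1 : ℝ) + 1) ^ d + ((x.2 : ℝ) + 1) ^ d) := by gcongr
    _ = _ := by
        rw [show -(u - d) = -u + d by ring, show -(v - d) = -v + d by ring,
          Real.rpow_add hx1, Real.rpow_add hx2]
        ring

theorem coeff_mul_le_of_le_rpow {f g : PowerSeries ℝ} {u v d : ℝ} (hd : 0 ≤ d) (hd1 : d ≤ 1)
    (hu : d ≤ u) (hv : d ≤ v) (huv : 1 < u + v - d) (hg : CoeffLE 0 g)
    {C D : ℝ} (hC : 0 ≤ C) (hf : ∀ n : ℕ, PowerSeries.coeff n f ≤ C * ((n : ℝ) + 1) ^ (-u))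
    (hg' : ∀ n : ℕ, PowerSeries.coeff n g ≤ D * ((n : ℝ) + 1) ^ (-v)) :
    ∃ K, 0 ≤ K ∧ ∀ m : ℕ, PowerSeries.coeff m (f * g) ≤ K * ((m : ℝ) + 1) ^ (-d) := by
  obtain ⟨K, hK, H⟩ := exists_sum_rpow_mul_rpow_le hd hd1 hu hv huv
  have hD : 0 ≤ D := by
    have h1 := hg' 0
    have h2 := hg 0
    simp only [map_zero, Nat.cast_zero, zero_add, Real.one_rpow, mul_one] at h1 h2
    linarith
  refine ⟨C * D * K, by positivity, fun m => ?_⟩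
  rw [PowerSeries.coeff_mul, mul_assoc]
  calc _ ≤ ∑ x ∈ Finset.HasAntidiagonal.antidiagonal m,
        C * D * (((x.1 : ℝ) + 1) ^ (-u) * ((x.2 : ℝ) + 1) ^ (-v)) :=
        Finset.sum_le_sum fun x _ => by
          refine (mul_le_mul (hf _) (hg' _) (by simpa using hg x.2) (by positivity)).trans_eq ?_
          ring
    _ ≤ _ := by
        rw [← Finset.mul_sum, ← mul_assoc, mul_assoc (C * D)]
        exact mul_le_mul_of_nonneg_left (H m) (by positivity)

end Convolution

/-! ### The generating series of the probabilities and its `s`-th power -/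

section PowerSequence

/-- The probability `n ^ (-1 + 1 / s) / s` that `n` is a pseudo `s`-th power. -/
noncomputable def powerProb (s n : ℕ) : ℝ := (n : ℝ) ^ (-1 + 1 / (s : ℝ)) / s

/-- The generating series of `powerProb s`. -/
noncomputable def powerProbSeries (s : ℕ) : PowerSeries ℝ := PowerSeries.mk (powerProb s)

theorem inv_natCast_bounds {s : ℕ} (hs : 2 ≤ s) :
    0 < 1 / (s : ℝ) ∧ 1 / (s : ℝ) ≤ 1 / 2 ∧ (s : ℝ) * (1 / s) = 1 := by
  have h : (2 : ℝ) ≤ s := by exact_mod_cast hs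
  refine ⟨by positivity, one_div_le_one_div_of_le (by norm_num) h, ?_⟩
  field_simp

theorem powerProb_nonneg (s n : ℕ) : 0 ≤ powerProb s n := by
  unfold powerProb
  positivity

/-- The exponent is nonzero, so the convention `0 ^ x = 0` gives the value required by `0 ∉ A`. -/
theorem powerProb_zero {s : ℕ} (hs : 2 ≤ s) : powerProb s 0 = 0 := by
  obtain ⟨h0, h1, -⟩ := inv_natCast_bounds hs
  rw [powerProb, Nat.cast_zero, Real.zero_rpow (by linarith), zero_div]

theorem powerProb_le_half {s : ℕ} (hs : 2 ≤ s) (n : ℕ) : powerProb s n ≤ 1 / 2 := by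
  obtain ⟨h0, h1, -⟩ := inv_natCast_bounds hs
  rcases eq_or_ne n 0 with rfl | hn
  · rw [powerProb_zero hs]
    norm_num
  · have : (n : ℝ) ^ (-1 + 1 / (s : ℝ)) ≤ 1 :=
      Real.rpow_le_one_of_one_le_of_nonpos (by exact_mod_cast Nat.one_le_iff_ne_zero.2 hn)
        (by linarith)
    rw [powerProb, div_eq_mul_one_div]
    nlinarith

theorem powerProbSeries_nonneg (s : ℕ) : CoeffLE 0 (powerProbSeries s) := fun n => by
  simpa [powerProbSeries] using powerProb_nonneg s n

/-- The constant `Γ(1 / s) / s`. -/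
noncomputable def gammaRatio (s : ℕ) : ℝ := Real.Gamma (1 / (s : ℝ)) / s

theorem gammaRatio_pos {s : ℕ} (hs : 2 ≤ s) : 0 < gammaRatio s := by
  obtain ⟨h0, -, -⟩ := inv_natCast_bounds hs
  have : (0 : ℝ) < s := by positivity
  exact div_pos (Real.Gamma_pos_of_pos h0) this

theorem gammaRatio_pow (s : ℕ) : gammaRatio s ^ s = s ! * lambdaConst s := by
  rw [gammaRatio, lambdaConst, div_pow]
  field_simp

theorem lambdaConst_pos {s : ℕ} (hs : 2 ≤ s) : 0 < lambdaConst s := by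
  have h1 := pow_pos (gammaRatio_pos hs) s
  rw [gammaRatio_pow] at h1
  exact pos_of_mul_pos_right h1 (by positivity)

theorem gammaRatio_mul_coeff_bounds {s : ℕ} (hs : 2 ≤ s) {n : ℕ} (hn : n ≠ 0) :
    gammaRatio s * PowerSeries.coeff n (negBinomialSeries (1 / s)) ≤ powerProb s n ∧
    ((n : ℝ) + 1) ^ (-1 + 1 / (s : ℝ)) / s ≤
      gammaRatio s * PowerSeries.coeff n (negBinomialSeries (1 / s)) := by
  obtain ⟨h0, h1, -⟩ := inv_natCast_bounds hs
  have hs0 : (0 : ℝ) < s := by positivity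
  have hn0 : (0 : ℝ) < n ! := by positivity
  have e1 := Gamma_nat_add_le h0 (by linarith) hn
  have e2 := le_Gamma_nat_add h0 (by linarith) n
  rw [Gamma_nat_add_eq h0, mul_left_comm, show 1 / (s : ℝ) - 1 = -1 + 1 / s by ring] at e1 e2
  have e1 := le_of_mul_le_mul_left e1 hn0
  have e2 := le_of_mul_le_mul_left e2 hn0
  rw [gammaRatio, powerProb, div_mul_eq_mul_div]
  exact ⟨div_le_div_of_nonneg_right e1 hs0.le, div_le_div_of_nonneg_right e2 hs0.le⟩

/-- Only the constant term needs correcting: there the comparison series has `gammaRatio s` and the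
probability is `0`. -/
theorem coeffLE_powerProbSeries_add {s : ℕ} (hs : 2 ≤ s) :
    CoeffLE (PowerSeries.C (gammaRatio s) * negBinomialSeries (1 / s))
      (powerProbSeries s + PowerSeries.C (gammaRatio s)) := fun n => by
  rw [map_add, PowerSeries.coeff_C_mul, powerProbSeries, PowerSeries.coeff_mk,
    PowerSeries.coeff_C]
  rcases eq_or_ne n 0 with rfl | hn
  · simp [negBinomialSeries, powerProb_nonneg]
  · simpa [hn] using (gammaRatio_mul_coeff_bounds hs hn).1

/-- The two Gamma bounds differ by the shift from `n` to `n + 1`, which gains a full power of `n` in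
the error. -/
theorem powerProbSeries_coeffLE_add {s : ℕ} (hs : 2 ≤ s) :
    CoeffLE (powerProbSeries s)
      (PowerSeries.C (gammaRatio s) * negBinomialSeries (1 / s) +
        PowerSeries.mk fun n : ℕ => 2 * ((n : ℝ) + 1) ^ (1 / (s : ℝ) - 2)) := fun n => by
  obtain ⟨h0, h1, -⟩ := inv_natCast_bounds hs
  have hs1 : (1 : ℝ) ≤ s := by exact_mod_cast (by lia : 1 ≤ s)
  rw [map_add, PowerSeries.coeff_C_mul, powerProbSeries, PowerSeries.coeff_mk,
    PowerSeries.coeff_mk]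
  rcases eq_or_ne n 0 with rfl | hn
  · rw [powerProb_zero hs]
    have := gammaRatio_pos hs
    simp [negBinomialSeries]
    positivity
  · have e1 := (gammaRatio_mul_coeff_bounds hs hn).2
    have e2 := rpow_sub_rpow_add_one_le h0 (by linarith) (x := n)
      (by exact_mod_cast Nat.one_le_iff_ne_zero.2 hn)
    rw [show 1 / (s : ℝ) - 1 = -1 + 1 / s by ring] at e2
    have e3 : ((n : ℝ) ^ (-1 + 1 / (s : ℝ)) - ((n : ℝ) + 1) ^ (-1 + 1 / (s : ℝ))) / s
        ≤ 2 * ((n : ℝ) + 1) ^ (1 / (s : ℝ) - 2) := by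
      rw [div_le_iff₀ (by positivity)]
      have : 0 < ((n : ℝ) + 1) ^ (1 / (s : ℝ) - 2) := by positivity
      nlinarith
    rw [sub_div] at e3
    rw [powerProb]
    linarith

theorem powerProbSeries_coeffLE {s : ℕ} (hs : 2 ≤ s) :
    CoeffLE (powerProbSeries s)
      (PowerSeries.C (2 * gammaRatio s) * negBinomialSeries (1 / s)) := fun n => by
  obtain ⟨h0, h1, -⟩ := inv_natCast_bounds hs
  have hs1 : (0 : ℝ) < s := by positivity
  rw [PowerSeries.coeff_C_mul, powerProbSeries, PowerSeries.coeff_mk]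
  rcases eq_or_ne n 0 with rfl | hn
  · rw [powerProb_zero hs]
    have := gammaRatio_pos hs
    simp [negBinomialSeries]
    positivity
  · have e1 := (gammaRatio_mul_coeff_bounds hs hn).2
    have e2 := rpow_le_two_mul_rpow_add_one (β := -1 + 1 / (s : ℝ)) (x := n) (by linarith)
      (by linarith) (by exact_mod_cast Nat.one_le_iff_ne_zero.2 hn)
    rw [div_le_iff₀ hs1] at e1
    rw [powerProb, div_le_iff₀ hs1]
    linarith

theorem exists_coeff_negBinomialSeries_pow_le {s : ℕ} (hs : 2 ≤ s) {k : ℕ} (hk : k ≤ s) :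
    ∃ C, 0 ≤ C ∧ ∀ n : ℕ, PowerSeries.coeff n (negBinomialSeries (1 / s) ^ k) ≤
      C * ((n : ℝ) + 1) ^ (k * (1 / (s : ℝ)) - 1) := by
  obtain ⟨h0, h1, h2⟩ := inv_natCast_bounds hs
  rw [← negBinomialSeries_natCast_mul]
  refine exists_coeff_negBinomialSeries_le (by positivity) ?_
  have hk' : (k : ℝ) ≤ s := by exact_mod_cast hk
  exact (mul_le_mul_of_nonneg_right hk' h0.le).trans_eq h2

theorem exists_coeff_powerProbSeries_pow_le {s : ℕ} (hs : 2 ≤ s) {k : ℕ} (hk : k ≤ s) :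
    ∃ C, 0 ≤ C ∧ ∀ n : ℕ, PowerSeries.coeff n (powerProbSeries s ^ k) ≤
      C * ((n : ℝ) + 1) ^ (k * (1 / (s : ℝ)) - 1) := by
  obtain ⟨C, hC, H⟩ := exists_coeff_negBinomialSeries_pow_le hs hk
  have hc := gammaRatio_pos hs
  refine ⟨(2 * gammaRatio s) ^ k * C, by positivity, fun n => ?_⟩
  have := (powerProbSeries_nonneg s).pow (powerProbSeries_coeffLE hs) k n
  rw [mul_pow, ← map_pow, PowerSeries.coeff_C_mul] at this
  refine this.trans ?_
  rw [mul_assoc]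
  exact mul_le_mul_of_nonneg_left (H n) (by positivity)

theorem exists_forall_coeff_powerProbSeries_pow_le {s : ℕ} (hs : 2 ≤ s) :
    ∃ C, 0 ≤ C ∧ ∀ k ≤ s, ∀ n : ℕ, PowerSeries.coeff n (powerProbSeries s ^ k) ≤
      C * ((n : ℝ) + 1) ^ (k * (1 / (s : ℝ)) - 1) := by
  have h : ∀ k : ℕ, ∃ C, 0 ≤ C ∧ (k ≤ s → ∀ n : ℕ,
      PowerSeries.coeff n (powerProbSeries s ^ k) ≤
        C * ((n : ℝ) + 1) ^ (k * (1 / (s : ℝ)) - 1)) := by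
    intro k
    by_cases hk : k ≤ s
    · obtain ⟨C, hC, H⟩ := exists_coeff_powerProbSeries_pow_le hs hk
      exact ⟨C, hC, fun _ => H⟩
    · exact ⟨0, le_rfl, fun h => absurd h hk⟩
  choose C hC H using h
  refine ⟨∑ k ∈ Finset.range (s + 1), C k, Finset.sum_nonneg fun k _ => hC k,
    fun k hk n => (H k hk n).trans ?_⟩
  gcongr
  exact Finset.single_le_sum (fun k _ => hC k) (Finset.mem_range.2 (by lia))

/-- The `s`-th power of `(1-X)^(-1/s)` is the geometric series; this is where the constant `λ_s`
originates. -/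
theorem coeff_gammaRatio_pow {s : ℕ} (hs : 2 ≤ s) (m : ℕ) :
    PowerSeries.coeff m ((PowerSeries.C (gammaRatio s) * negBinomialSeries (1 / s)) ^ s) =
      gammaRatio s ^ s := by
  rw [mul_pow, ← negBinomialSeries_natCast_mul, (inv_natCast_bounds hs).2.2, ← map_pow,
    PowerSeries.coeff_C_mul, coeff_negBinomialSeries_one, mul_one]

/-- The factors are exchanged one at a time: the sharp comparison acts on the main term, while the
comparison with factor `2` suffices on the error. All errors then take the form `E * Q ^ (s - 1)`.
-/
theorem exists_coeff_powerProbSeries_pow_le_add {s : ℕ} (hs : 2 ≤ s) :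
    ∃ C, 0 ≤ C ∧ ∀ m : ℕ, PowerSeries.coeff m (powerProbSeries s ^ s) ≤
      gammaRatio s ^ s + C * ((m : ℝ) + 1) ^ (-(1 / (s : ℝ) / 2)) := by
  obtain ⟨h0, h1, h2⟩ := inv_natCast_bounds hs
  have hc := gammaRatio_pos hs
  set Q := negBinomialSeries (1 / (s : ℝ)) with hQ
  set E : PowerSeries ℝ := PowerSeries.mk fun n : ℕ => 2 * ((n : ℝ) + 1) ^ (1 / (s : ℝ) - 2)
    with hE
  have hQ0 : CoeffLE 0 Q := negBinomialSeries_nonneg h0.le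
  have hE0 : CoeffLE 0 E := fun n => by
    simp only [hE, map_zero, PowerSeries.coeff_mk]
    positivity
  have hcQ : CoeffLE 0 (PowerSeries.C (gammaRatio s) * Q) :=
    (CoeffLE.C_nonneg hc.le).mul_nonneg hQ0
  have hrec : ∀ k : ℕ, ∃ K, 0 ≤ K ∧ CoeffLE (powerProbSeries s ^ (k + 1))
      ((PowerSeries.C (gammaRatio s) * Q) ^ (k + 1) + PowerSeries.C K * (E * Q ^ k)) := by
    intro k
    induction k with
    | zero =>
      refine ⟨1, zero_le_one, ?_⟩
      rw [zero_add, pow_one, pow_one, pow_zero, map_one, one_mul, mul_one]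
      exact powerProbSeries_coeffLE_add hs
    | succ k ih =>
      obtain ⟨K, hK, H⟩ := ih
      refine ⟨gammaRatio s ^ (k + 1) + K * (2 * gammaRatio s), by positivity, ?_⟩
      rw [pow_succ]
      refine (H.mul_right (powerProbSeries_nonneg s)).trans ?_
      rw [add_mul]
      refine ((powerProbSeries_coeffLE_add hs).mul_left (hcQ.pow_nonneg _)).add
        ((powerProbSeries_coeffLE hs).mul_left
          ((CoeffLE.C_nonneg hK).mul_nonneg (hE0.mul_nonneg (hQ0.pow_nonneg k)))) |>.trans ?_
      convert CoeffLE.refl _ using 1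
      simp only [map_add, map_mul, map_pow]
      ring
  obtain ⟨k, rfl⟩ : ∃ k, s = k + 1 := ⟨s - 1, by lia⟩
  obtain ⟨K, hK, H⟩ := hrec k
  obtain ⟨D, hD, HD⟩ := exists_coeff_negBinomialSeries_pow_le hs (k := k) (by lia)
  have hk : (k : ℝ) * (1 / ((k + 1 : ℕ) : ℝ)) - 1 = -(1 / ((k + 1 : ℕ) : ℝ)) := by
    push_cast at h2 ⊢
    linarith
  rw [hk] at HD
  -- The exponent `1/(2s)` is used for every error. Half of `1/s` leaves the strict inequality that
  -- the convolution bound needs for overlapping pairs.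
  obtain ⟨M, hM, HM⟩ := coeff_mul_le_of_le_rpow (f := E) (g := Q ^ k)
    (u := 2 - 1 / ((k + 1 : ℕ) : ℝ)) (v := 1 / ((k + 1 : ℕ) : ℝ))
    (d := 1 / ((k + 1 : ℕ) : ℝ) / 2)
    (by linarith) (by linarith) (by linarith) (by linarith) (by linarith)
    (hQ0.pow_nonneg k) zero_le_two (fun n => by rw [hE, PowerSeries.coeff_mk, neg_sub]) HD
  refine ⟨K * M, by positivity, fun m => (H m).trans ?_⟩
  rw [map_add, coeff_gammaRatio_pow hs, PowerSeries.coeff_C_mul, mul_assoc]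
  exact add_le_add le_rfl (mul_le_mul_of_nonneg_left (HM m) hK)

/-- Expanding the `s`-th power of the corrected series, the terms with `j < s` have coefficients
`O((m+1)^(j/s - 1))`, of lower order. -/
theorem exists_le_coeff_powerProbSeries_pow {s : ℕ} (hs : 2 ≤ s) :
    ∃ C, 0 ≤ C ∧ ∀ m : ℕ, gammaRatio s ^ s - C * ((m : ℝ) + 1) ^ (-(1 / (s : ℝ) / 2)) ≤
      PowerSeries.coeff m (powerProbSeries s ^ s) := by
  obtain ⟨h0, h1, h2⟩ := inv_natCast_bounds hs
  have hc := gammaRatio_pos hs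
  obtain ⟨C, hC, H⟩ := exists_forall_coeff_powerProbSeries_pow_le hs
  refine ⟨∑ j ∈ Finset.range s, C * (gammaRatio s ^ (s - j) * (s.choose j)), ?_, fun m => ?_⟩
  · exact Finset.sum_nonneg fun j _ => by positivity
  have key := ((CoeffLE.C_nonneg hc.le).mul_nonneg (negBinomialSeries_nonneg h0.le)).pow
    (coeffLE_powerProbSeries_add hs) s m
  rw [coeff_gammaRatio_pow hs, add_pow, Finset.sum_range_succ, map_add, map_sum] at key
  simp only [Nat.sub_self, pow_zero, Nat.choose_self, Nat.cast_one, mul_one] at key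
  have hle : ∑ j ∈ Finset.range s, PowerSeries.coeff m (powerProbSeries s ^ j *
      PowerSeries.C (gammaRatio s) ^ (s - j) * ((s.choose j : ℕ) : PowerSeries ℝ)) ≤
      (∑ j ∈ Finset.range s, C * (gammaRatio s ^ (s - j) * (s.choose j))) *
        ((m : ℝ) + 1) ^ (-(1 / (s : ℝ) / 2)) := by
    rw [Finset.sum_mul]
    refine Finset.sum_le_sum fun j hj => ?_
    have hj' := Finset.mem_range.1 hj
    have e : powerProbSeries s ^ j * PowerSeries.C (gammaRatio s) ^ (s - j) *
        ((s.choose j : ℕ) : PowerSeries ℝ) =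
        PowerSeries.C (gammaRatio s ^ (s - j) * (s.choose j)) * powerProbSeries s ^ j := by
      rw [map_mul, map_pow, map_natCast]
      ring
    rw [e, PowerSeries.coeff_C_mul]
    have hpos : 0 ≤ gammaRatio s ^ (s - j) * (s.choose j : ℝ) := by positivity
    have hexp : ((m : ℝ) + 1) ^ (j * (1 / (s : ℝ)) - 1) ≤
        ((m : ℝ) + 1) ^ (-(1 / (s : ℝ) / 2)) := by
      refine Real.rpow_le_rpow_of_exponent_le (by linarith [(Nat.cast_nonneg m : (0 : ℝ) ≤ m)]) ?_
      have : ((j : ℝ) + 1) * (1 / s) ≤ s * (1 / s) :=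
        mul_le_mul_of_nonneg_right (by exact_mod_cast hj') h0.le
      linarith
    calc _ ≤ gammaRatio s ^ (s - j) * (s.choose j : ℝ) *
          (C * ((m : ℝ) + 1) ^ (-(1 / (s : ℝ) / 2))) :=
          mul_le_mul_of_nonneg_left ((H j hj'.le m).trans (by gcongr)) hpos
      _ = _ := by ring
  linarith

end PowerSequence

/-! ### Sets with prescribed sum: mean number of representations and overlapping pairs -/

section SumSets

/-- The finite sets of `k` natural numbers with sum `m`. -/
def sumSets (k m : ℕ) : Finset (Finset ℕ) :=
  ((Finset.range (m + 1)).powersetCard k).filter fun S => ∑ a ∈ S, a = m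

theorem mem_sumSets {k m : ℕ} {S : Finset ℕ} :
    S ∈ sumSets k m ↔ S.card = k ∧ ∑ a ∈ S, a = m := by
  simp only [sumSets, Finset.mem_filter, Finset.mem_powersetCard]
  refine ⟨fun h => ⟨h.1.2, h.2⟩, fun h => ⟨⟨fun a ha => ?_, h.1⟩, h.2⟩⟩
  have := Finset.single_le_sum (f := fun a : ℕ => a) (fun _ _ => Nat.zero_le _) ha
  rw [Finset.mem_range]
  simp only [h.2] at this
  lia

/-- The sum over all `k`-element sets `S` with sum `m` of the product of `p` over `S`. -/
noncomputable def sumWeight (p : ℕ → ℝ) (k m : ℕ) : ℝ := ∑ S ∈ sumSets k m, ∏ a ∈ S, p a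

variable {p : ℕ → ℝ}

theorem sumWeight_nonneg (hp : ∀ n, 0 ≤ p n) (k m : ℕ) : 0 ≤ sumWeight p k m :=
  Finset.sum_nonneg fun _ _ => Finset.prod_nonneg fun _ _ => hp _

theorem sum_sumSets_mem_eq (p : ℕ → ℝ) (k a j : ℕ) :
    ∑ S ∈ sumSets (k + 1) (a + j) with a ∈ S, ∏ b ∈ S, p b =
      p a * ∑ S ∈ sumSets k j with a ∉ S, ∏ b ∈ S, p b := by
  rw [Finset.mul_sum]
  refine Finset.sum_nbij' (fun S => S.erase a) (fun S => insert a S) ?_ ?_ ?_ ?_ ?_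
  · intro S hS
    simp only [Finset.mem_filter, mem_sumSets] at hS ⊢
    refine ⟨⟨?_, ?_⟩, Finset.notMem_erase _ _⟩
    · rw [Finset.card_erase_of_mem hS.2, hS.1.1, Nat.add_sub_cancel]
    · have := Finset.add_sum_erase S (fun b : ℕ => b) hS.2
      simp only [hS.1.2] at this
      lia
  · intro S hS
    simp only [Finset.mem_filter, mem_sumSets] at hS ⊢
    refine ⟨⟨?_, ?_⟩, Finset.mem_insert_self _ _⟩
    · rw [Finset.card_insert_of_notMem hS.2, hS.1.1]
    · rw [Finset.sum_insert hS.2, hS.1.2]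
  · intro S hS
    exact Finset.insert_erase (Finset.mem_filter.1 hS).2
  · intro S hS
    exact Finset.erase_insert (Finset.mem_filter.1 hS).2
  · intro S hS
    exact (Finset.mul_prod_erase S p (Finset.mem_filter.1 hS).2).symm

/-- Double counting of sets with a marked element, which is then removed. -/
theorem succ_mul_sumWeight_succ (p : ℕ → ℝ) (k m : ℕ) :
    (k + 1 : ℝ) * sumWeight p (k + 1) m = ∑ x ∈ Finset.HasAntidiagonal.antidiagonal m,
      p x.1 * ∑ S ∈ sumSets k x.2 with x.1 ∉ S, ∏ b ∈ S, p b := by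
  have h1 : (k + 1 : ℝ) * sumWeight p (k + 1) m =
      ∑ S ∈ sumSets (k + 1) m, ∑ a ∈ Finset.range (m + 1),
        if a ∈ S then ∏ b ∈ S, p b else 0 := by
    rw [sumWeight, Finset.mul_sum]
    refine Finset.sum_congr rfl fun S hS => ?_
    have hsub : Finset.range (m + 1) ∩ S = S :=
      Finset.inter_eq_right.2 (Finset.mem_powersetCard.1 (Finset.mem_filter.1 hS).1).1
    rw [Finset.sum_ite_mem, hsub, Finset.sum_const, (mem_sumSets.1 hS).1, nsmul_eq_mul]
    push_cast
    ring
  rw [h1, Finset.sum_comm, Finset.Nat.sum_antidiagonal_eq_sum_range_succ_mk]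
  refine Finset.sum_congr rfl fun a ha => ?_
  have ha' : a ≤ m := by simpa [Nat.lt_succ_iff] using ha
  rw [← Finset.sum_filter, ← sum_sumSets_mem_eq, Nat.add_sub_cancel' ha']

/-- The generating series of `sumWeight p k`. -/
noncomputable def sumWeightSeries (p : ℕ → ℝ) (k : ℕ) : PowerSeries ℝ :=
  PowerSeries.mk (sumWeight p k)

theorem sumWeightSeries_nonneg (hp : ∀ n, 0 ≤ p n) (k : ℕ) :
    CoeffLE 0 (sumWeightSeries p k) := fun n => by
  simpa [sumWeightSeries] using sumWeight_nonneg hp k n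

theorem mk_nonneg (hp : ∀ n, 0 ≤ p n) : CoeffLE 0 (PowerSeries.mk p) := fun n => by
  simpa using hp n

theorem sumWeightSeries_zero (p : ℕ → ℝ) : sumWeightSeries p 0 = 1 := by
  ext m
  rw [sumWeightSeries, PowerSeries.coeff_mk, sumWeight, PowerSeries.coeff_one]
  split_ifs with h
  · have : sumSets 0 m = {∅} := by
      ext S
      simp only [mem_sumSets, Finset.card_eq_zero, Finset.mem_singleton]
      exact ⟨fun h => h.1, fun h' => ⟨h', by simp [h', h]⟩⟩
    simp [this]
  · refine Finset.sum_eq_zero fun S hS => absurd ?_ h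
    obtain ⟨h1, h2⟩ := mem_sumSets.1 hS
    rw [Finset.card_eq_zero] at h1
    simpa [h1] using h2.symm

theorem succ_mul_sumWeightSeries_succ_coeffLE (hp : ∀ n, 0 ≤ p n) (k : ℕ) :
    CoeffLE (PowerSeries.C (k + 1 : ℝ) * sumWeightSeries p (k + 1))
      (PowerSeries.mk p * sumWeightSeries p k) := fun m => by
  rw [PowerSeries.coeff_C_mul, sumWeightSeries, PowerSeries.coeff_mk, succ_mul_sumWeight_succ,
    PowerSeries.coeff_mul]
  refine Finset.sum_le_sum fun x _ => ?_
  rw [sumWeightSeries, PowerSeries.coeff_mk, PowerSeries.coeff_mk]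
  refine mul_le_mul_of_nonneg_left ?_ (hp _)
  exact Finset.sum_le_sum_of_subset_of_nonneg (Finset.filter_subset _ _)
    fun _ _ _ => Finset.prod_nonneg fun _ _ => hp _

theorem factorial_mul_sumWeightSeries_coeffLE (hp : ∀ n, 0 ≤ p n) (k : ℕ) :
    CoeffLE (PowerSeries.C (k ! : ℝ) * sumWeightSeries p k) (PowerSeries.mk p ^ k) := by
  induction k with
  | zero =>
    rw [sumWeightSeries_zero]
    simpa using CoeffLE.refl 1
  | succ k ih =>
    have h1 := (succ_mul_sumWeightSeries_succ_coeffLE hp k).mul_left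
      (CoeffLE.C_nonneg (Nat.cast_nonneg (α := ℝ) k !))
    have h2 := ih.mul_left (mk_nonneg hp)
    rw [← mul_assoc, ← map_mul] at h1
    rw [pow_succ', Nat.factorial_succ, Nat.cast_mul, Nat.cast_succ, mul_comm ((k : ℝ) + 1)]
    refine h1.trans (CoeffLE.trans ?_ h2)
    convert CoeffLE.refl _ using 1
    ring

theorem sumWeight_le_coeff (hp : ∀ n, 0 ≤ p n) (k m : ℕ) :
    sumWeight p k m ≤ PowerSeries.coeff m (PowerSeries.mk p ^ k) := by
  have h := factorial_mul_sumWeightSeries_coeffLE hp k m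
  rw [PowerSeries.coeff_C_mul, sumWeightSeries, PowerSeries.coeff_mk] at h
  refine le_trans ?_ h
  exact le_mul_of_one_le_left (sumWeight_nonneg hp k m)
    (by exact_mod_cast Nat.succ_le_of_lt (Nat.factorial_pos k))

/-- The series `∑ p(a)² X^(2a)`. -/
noncomputable def diagonalSeries (p : ℕ → ℝ) : PowerSeries ℝ :=
  PowerSeries.mk fun n => if Even n then p (n / 2) ^ 2 else 0

theorem diagonalSeries_nonneg (p : ℕ → ℝ) : CoeffLE 0 (diagonalSeries p) := fun n => by
  rw [diagonalSeries, PowerSeries.coeff_mk, map_zero]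
  split_ifs <;> positivity

/-- The left side counts pairs `(a, S)`. Those with `a ∉ S` give a larger set with a marked element.
Those with `a ∈ S` use `a` twice: they contribute `p(a)²` and use up `2a` of the sum, hence the
diagonal series. -/
theorem mk_mul_sumWeightSeries_succ_coeffLE (hp : ∀ n, 0 ≤ p n) (k : ℕ) :
    CoeffLE (PowerSeries.mk p * sumWeightSeries p (k + 1))
      (PowerSeries.C (k + 2 : ℝ) * sumWeightSeries p (k + 2) +
        diagonalSeries p * sumWeightSeries p k) := fun m => by
  have hw : ∀ S : Finset ℕ, 0 ≤ ∏ b ∈ S, p b := fun S => Finset.prod_nonneg fun _ _ => hp _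
  have h0 := succ_mul_sumWeight_succ p (k + 1) m
  have h1 : (k + 2 : ℝ) * sumWeight p (k + 2) m = ((k + 1 : ℕ) + 1 : ℝ) *
      sumWeight p (k + 1 + 1) m := by
    push_cast
    ring
  have h2 : PowerSeries.coeff m (PowerSeries.mk p * sumWeightSeries p (k + 1)) =
      (k + 2 : ℝ) * sumWeight p (k + 2) m + ∑ x ∈ Finset.HasAntidiagonal.antidiagonal m,
        p x.1 * ∑ S ∈ sumSets (k + 1) x.2 with x.1 ∈ S, ∏ b ∈ S, p b := by
    rw [h1, h0, PowerSeries.coeff_mul, ← Finset.sum_add_distrib]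
    refine Finset.sum_congr rfl fun x _ => ?_
    rw [sumWeightSeries, PowerSeries.coeff_mk, PowerSeries.coeff_mk, sumWeight, ← mul_add,
      add_comm (∑ S ∈ sumSets (k + 1) x.2 with x.1 ∉ S, ∏ b ∈ S, p b),
      Finset.sum_filter_add_sum_filter_not]
  rw [h2, map_add, PowerSeries.coeff_C_mul]
  refine add_le_add (by rw [sumWeightSeries, PowerSeries.coeff_mk]) ?_
  set g : ℕ × ℕ → ℝ := fun y => PowerSeries.coeff y.1 (diagonalSeries p) *
    PowerSeries.coeff y.2 (sumWeightSeries p k) with hg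
  have hg0 : ∀ y, 0 ≤ g y := fun y => mul_nonneg (by simpa using diagonalSeries_nonneg p y.1)
    (by simpa using sumWeightSeries_nonneg hp k y.2)
  calc ∑ x ∈ Finset.HasAntidiagonal.antidiagonal m,
        p x.1 * ∑ S ∈ sumSets (k + 1) x.2 with x.1 ∈ S, ∏ b ∈ S, p b
      ≤ ∑ x ∈ Finset.HasAntidiagonal.antidiagonal m,
        if 2 * x.1 ≤ m then g (2 * x.1, m - 2 * x.1) else 0 := by
        refine Finset.sum_le_sum fun x hx => ?_
        have hx' : x.1 + x.2 = m := Finset.HasAntidiagonal.mem_antidiagonal.1 hx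
        split_ifs with h
        · obtain ⟨j, hj⟩ : ∃ j, x.2 = x.1 + j := ⟨x.2 - x.1, by lia⟩
          rw [hj, sum_sumSets_mem_eq, show m - 2 * x.1 = j by lia]
          simp only [hg, diagonalSeries, sumWeightSeries, PowerSeries.coeff_mk, even_two_mul,
            if_true]
          rw [← mul_assoc, ← sq, Nat.mul_div_cancel_left _ two_pos]
          refine mul_le_mul_of_nonneg_left ?_ (by positivity)
          exact Finset.sum_le_sum_of_subset_of_nonneg (Finset.filter_subset _ _)
            fun S _ _ => hw S
        · rw [Finset.filter_false_of_mem, Finset.sum_empty, mul_zero]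
          intro S hS hxS
          have h3 := Finset.single_le_sum (f := fun a : ℕ => a) (fun _ _ => Nat.zero_le _) hxS
          simp only [(mem_sumSets.1 hS).2] at h3
          lia
    _ = ∑ x ∈ Finset.HasAntidiagonal.antidiagonal m with 2 * x.1 ≤ m,
          g (2 * x.1, m - 2 * x.1) := (Finset.sum_filter _ _).symm
    _ = ∑ y ∈ (Finset.filter (fun x : ℕ × ℕ => 2 * x.1 ≤ m)
          (Finset.HasAntidiagonal.antidiagonal m)).image
            fun x : ℕ × ℕ => (2 * x.1, m - 2 * x.1), g y := by
        rw [Finset.sum_image]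
        intro x hx y hy hxy
        simp only [Finset.coe_filter, Finset.HasAntidiagonal.mem_antidiagonal,
          Set.mem_ofPred_eq] at hx hy
        simp only [Prod.mk.injEq] at hxy
        ext <;> lia
    _ ≤ ∑ y ∈ Finset.HasAntidiagonal.antidiagonal m, g y := by
        refine Finset.sum_le_sum_of_subset_of_nonneg ?_ fun y _ _ => hg0 y
        intro y hy
        obtain ⟨x, hx, rfl⟩ := Finset.mem_image.1 hy
        rw [Finset.mem_filter] at hx
        rw [Finset.HasAntidiagonal.mem_antidiagonal]
        exact Nat.add_sub_cancel' hx.2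
    _ = _ := by rw [PowerSeries.coeff_mul]

/-- Converse to `factorial_mul_sumWeightSeries_coeffLE`: tuples with a repeated entry are absorbed
by the diagonal term. -/
theorem exists_mk_pow_coeffLE (hp : ∀ n, 0 ≤ p n) (k : ℕ) :
    ∃ K, 0 ≤ K ∧ CoeffLE (PowerSeries.mk p ^ (k + 2))
      (PowerSeries.C ((k + 2)! : ℝ) * sumWeightSeries p (k + 2) +
        PowerSeries.C K * (diagonalSeries p * PowerSeries.mk p ^ k)) := by
  have hstep : ∀ k : ℕ, CoeffLE
      (PowerSeries.mk p * (PowerSeries.C ((k + 1)! : ℝ) * sumWeightSeries p (k + 1)))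
      (PowerSeries.C ((k + 2)! : ℝ) * sumWeightSeries p (k + 2) +
        PowerSeries.C (k + 1 : ℝ) * (diagonalSeries p * PowerSeries.mk p ^ k)) := by
    intro k
    have h1 := (mk_mul_sumWeightSeries_succ_coeffLE hp k).mul_left
      (CoeffLE.C_nonneg (Nat.cast_nonneg (α := ℝ) (k + 1)!))
    have h2 := (factorial_mul_sumWeightSeries_coeffLE hp k).mul_left
      ((CoeffLE.C_nonneg (by positivity : (0 : ℝ) ≤ k + 1)).mul_nonneg (diagonalSeries_nonneg p))
    have e1 : ((k + 2)! : ℝ) = (k + 1)! * (k + 2) := by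
      rw [Nat.factorial_succ (k + 1)]
      push_cast
      ring
    have e2 : ((k + 1)! : ℝ) = k ! * (k + 1) := by
      rw [Nat.factorial_succ k]
      push_cast
      ring
    rw [mul_left_comm]
    refine h1.trans ?_
    rw [mul_add, ← mul_assoc, ← map_mul, ← e1, ← mul_assoc (PowerSeries.C (k + 1 : ℝ))]
    refine (CoeffLE.refl _).add (CoeffLE.trans ?_ h2)
    rw [e2, map_mul]
    convert CoeffLE.refl _ using 1
    ring
  induction k with
  | zero =>
    refine ⟨1, zero_le_one, ?_⟩
    have h1 := hstep 0
    have h0 : CoeffLE (PowerSeries.mk p)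
        (PowerSeries.C ((0 + 1)! : ℝ) * sumWeightSeries p (0 + 1)) := by
      intro m
      have := succ_mul_sumWeight_succ p 0 m
      simp only [Nat.cast_zero, zero_add, one_mul] at this
      rw [PowerSeries.coeff_C_mul, sumWeightSeries, PowerSeries.coeff_mk, PowerSeries.coeff_mk, zero_add,
        this]
      have h00 : sumSets 0 0 = {∅} := by
        ext S
        simp only [mem_sumSets, Finset.card_eq_zero, Finset.mem_singleton]
        exact ⟨fun h => h.1, fun h' => ⟨h', by simp [h']⟩⟩
      have hmem : (m, 0) ∈ Finset.HasAntidiagonal.antidiagonal m := by simp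
      rw [Nat.factorial_one, Nat.cast_one, one_mul]
      refine le_trans ?_ (Finset.single_le_sum (fun x _ => mul_nonneg (hp x.1)
        (Finset.sum_nonneg fun S _ => Finset.prod_nonneg fun _ _ => hp _)) hmem)
      simp [h00, Finset.filter_singleton]
    rw [zero_add, sq]
    refine (h0.mul_left (mk_nonneg hp)).trans (h1.trans ?_)
    convert CoeffLE.refl _ using 3
    simp
  | succ k ih =>
    obtain ⟨K, hK, H⟩ := ih
    refine ⟨(k + 1 : ℕ) + 1 + K, by positivity, ?_⟩
    rw [pow_succ']
    refine (H.mul_left (mk_nonneg hp)).trans ?_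
    rw [mul_add]
    refine ((hstep (k + 1)).add (CoeffLE.refl _)).trans ?_
    convert CoeffLE.refl _ using 1
    rw [map_add]
    ring

/-- Passing from `a` to `a + 1` and then to `2a + 2` costs a factor `2` each time, and `16` is the
square of `4`. -/
theorem coeff_diagonalSeries_le {s : ℕ} (hs : 2 ≤ s) :
    ∀ n : ℕ, PowerSeries.coeff n (diagonalSeries (powerProb s)) ≤
      16 * ((n : ℝ) + 1) ^ (-(2 - 2 * (1 / (s : ℝ)))) := by
  intro n
  obtain ⟨h0, h1, -⟩ := inv_natCast_bounds hs
  have hs1 : (1 : ℝ) ≤ s := by exact_mod_cast (by lia : 1 ≤ s)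
  rw [diagonalSeries, PowerSeries.coeff_mk]
  split_ifs with h
  · obtain ⟨a, rfl⟩ := h.two_dvd
    rw [Nat.mul_div_cancel_left _ two_pos]
    rcases eq_or_ne a 0 with rfl | ha
    · rw [powerProb_zero hs]
      simp
    · have ha1 : (1 : ℝ) ≤ a := by exact_mod_cast Nat.one_le_iff_ne_zero.2 ha
      have e1 := rpow_le_two_mul_rpow_add_one (β := -1 + 1 / (s : ℝ)) (x := a) (by linarith)
        (by linarith) ha1
      have e2 := rpow_le_two_mul_rpow_add_one (β := -1 + 1 / (s : ℝ)) (x := a + a)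
        (by linarith) (by linarith) (by linarith)
      have e3 : ((a : ℝ) + 1) ^ (-1 + 1 / (s : ℝ)) ≤
          2 * ((a : ℝ) + 1 + (a + 1)) ^ (-1 + 1 / (s : ℝ)) := by
        have h2 : (2 : ℝ) ^ (-1 : ℝ) ≤ 2 ^ (-1 + 1 / (s : ℝ)) :=
          Real.rpow_le_rpow_of_exponent_le (by norm_num) (by linarith)
        rw [Real.rpow_neg_one] at h2
        rw [← two_mul, Real.mul_rpow (by norm_num) (by positivity)]
        have h3 : 0 < ((a : ℝ) + 1) ^ (-1 + 1 / (s : ℝ)) := by positivity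
        nlinarith
      have e4 : ((a : ℝ) + 1 + (a + 1)) ^ (-1 + 1 / (s : ℝ)) ≤
          (((2 * a : ℕ) : ℝ) + 1) ^ (-1 + 1 / (s : ℝ)) := by
        refine Real.rpow_le_rpow_of_nonpos (by positivity) ?_ (by linarith)
        push_cast
        linarith
      have e5 : powerProb s a ≤ 4 * (((2 * a : ℕ) : ℝ) + 1) ^ (-1 + 1 / (s : ℝ)) := by
        rw [powerProb, div_le_iff₀ (by positivity)]
        have : 0 < (((2 * a : ℕ) : ℝ) + 1) ^ (-1 + 1 / (s : ℝ)) := by positivity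
        nlinarith
      calc powerProb s a ^ 2 ≤ (4 * (((2 * a : ℕ) : ℝ) + 1) ^ (-1 + 1 / (s : ℝ))) ^ 2 :=
            pow_le_pow_left₀ (powerProb_nonneg _ _) e5 2
        _ = _ := by
            rw [mul_pow, ← Real.rpow_natCast (_ ^ _), ← Real.rpow_mul (by positivity)]
            push_cast
            norm_num
            ring_nf
  · positivity

theorem exists_sumWeight_powerProb_le {s : ℕ} (hs : 2 ≤ s) :
    ∃ C, 0 ≤ C ∧ ∀ k ≤ s, ∀ m : ℕ, sumWeight (powerProb s) k m ≤
      C * ((m : ℝ) + 1) ^ (k * (1 / (s : ℝ)) - 1) := by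
  obtain ⟨C, hC, H⟩ := exists_forall_coeff_powerProbSeries_pow_le hs
  exact ⟨C, hC, fun k hk m => (sumWeight_le_coeff (powerProb_nonneg s) k m).trans (H k hk m)⟩

/-- The expected number of representations of `m` as a sum of `s` distinct pseudo `s`-th powers
tends to `λ_s` with a power saving. -/
theorem exists_abs_sumWeight_sub_le {s : ℕ} (hs : 2 ≤ s) :
    ∃ C, 0 ≤ C ∧ ∀ m : ℕ, |sumWeight (powerProb s) s m - lambdaConst s| ≤
      C * ((m : ℝ) + 1) ^ (-(1 / (s : ℝ) / 2)) := by
  obtain ⟨h0, h1, h2⟩ := inv_natCast_bounds hs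
  have hp := powerProb_nonneg s
  have hf : (0 : ℝ) < s ! := by positivity
  have hf1 : (1 : ℝ) ≤ s ! := by exact_mod_cast Nat.succ_le_of_lt (Nat.factorial_pos s)
  obtain ⟨C₁, hC₁, H₁⟩ := exists_coeff_powerProbSeries_pow_le_add hs
  obtain ⟨C₂, hC₂, H₂⟩ := exists_le_coeff_powerProbSeries_pow hs
  obtain ⟨k, rfl⟩ : ∃ k, s = k + 2 := ⟨s - 2, by lia⟩
  obtain ⟨K, hK, H⟩ := exists_mk_pow_coeffLE hp k
  obtain ⟨D, hD, HD⟩ := exists_coeff_powerProbSeries_pow_le hs (k := k) (by lia)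
  have hk : (k : ℝ) * (1 / ((k + 2 : ℕ) : ℝ)) - 1 = -(2 * (1 / ((k + 2 : ℕ) : ℝ))) := by
    push_cast at h2 ⊢
    linarith
  rw [hk] at HD
  obtain ⟨M, hM, HM⟩ := coeff_mul_le_of_le_rpow (f := diagonalSeries (powerProb (k + 2)))
    (d := 1 / ((k + 2 : ℕ) : ℝ) / 2) (by linarith) (by linarith) (by linarith) (by linarith)
    (by linarith) ((powerProbSeries_nonneg (k + 2)).pow_nonneg k) (by norm_num : (0 : ℝ) ≤ 16)
    (coeff_diagonalSeries_le hs) HD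
  refine ⟨C₁ + C₂ + K * M, by positivity, fun m => ?_⟩
  set W := sumWeight (powerProb (k + 2)) (k + 2) m with hW
  set e := ((m : ℝ) + 1) ^ (-(1 / ((k + 2 : ℕ) : ℝ) / 2)) with he
  have he0 : 0 < e := by positivity
  have hup := factorial_mul_sumWeightSeries_coeffLE hp (k + 2) m
  have hlo := H m
  rw [PowerSeries.coeff_C_mul, sumWeightSeries, PowerSeries.coeff_mk] at hup
  rw [map_add, PowerSeries.coeff_C_mul, PowerSeries.coeff_C_mul, sumWeightSeries,
    PowerSeries.coeff_mk] at hlo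
  have a1 := H₁ m
  have a2 := H₂ m
  have a3 := mul_le_mul_of_nonneg_left (HM m) hK
  rw [gammaRatio_pow] at a1 a2
  unfold powerProbSeries at a1 a2 a3
  -- `s! W` is at most the coefficient of the `s`-th power and falls short of it by at most the
  -- diagonal term; that coefficient is close to `s! λ_s`.
  have key : |((k + 2)! : ℝ) * (W - lambdaConst (k + 2))| ≤ (C₁ + C₂ + K * M) * e := by
    rw [abs_le]
    have b1 : 0 ≤ C₁ * e := by positivity
    have b2 : 0 ≤ C₂ * e := by positivity
    have b3 : 0 ≤ K * M * e := by positivity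
    constructor <;> linarith
  rw [abs_mul, abs_of_pos hf] at key
  exact (le_mul_of_one_le_left (abs_nonneg _) hf1).trans key

/-- A pair is recovered from `(S ∩ T, S \ T, T \ S)`. Here `k` and `j` are the size and the sum of
the intersection, and the product over `S ∪ T` factors accordingly. -/
theorem sum_pairs_le (hp : ∀ n, 0 ≤ p n) (s m m' : ℕ) :
    ∑ S ∈ sumSets s m, ∑ T ∈ sumSets s m',
      (if S ≠ T ∧ ¬ Disjoint S T then ∏ a ∈ S ∪ T, p a else 0) ≤
    ∑ k ∈ Finset.Ico 1 s, ∑ j ∈ Finset.range (min m m' + 1),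
      sumWeight p k j * (sumWeight p (s - k) (m - j) * sumWeight p (s - k) (m' - j)) := by
  have hw : ∀ S : Finset ℕ, 0 ≤ ∏ b ∈ S, p b := fun S => Finset.prod_nonneg fun _ _ => hp _
  set I := Finset.Ico 1 s ×ˢ Finset.range (min m m' + 1) with hI
  set U : Finset (Σ _ : ℕ × ℕ, Finset ℕ × Finset ℕ × Finset ℕ) := I.sigma fun x =>
    sumSets x.1 x.2 ×ˢ sumSets (s - x.1) (m - x.2) ×ˢ sumSets (s - x.1) (m' - x.2) with hU
  set g : (Σ _ : ℕ × ℕ, Finset ℕ × Finset ℕ × Finset ℕ) → ℝ := fun y =>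
    (∏ a ∈ y.2.1, p a) * ((∏ a ∈ y.2.2.1, p a) * ∏ a ∈ y.2.2.2, p a) with hg
  have hR : ∑ k ∈ Finset.Ico 1 s, ∑ j ∈ Finset.range (min m m' + 1),
      sumWeight p k j * (sumWeight p (s - k) (m - j) * sumWeight p (s - k) (m' - j)) =
      ∑ y ∈ U, g y := by
    rw [hU, Finset.sum_sigma, hI, Finset.sum_product]
    refine Finset.sum_congr rfl fun k _ => Finset.sum_congr rfl fun j _ => ?_
    simp only [sumWeight, hg, Finset.sum_product, ← Finset.mul_sum, ← Finset.sum_mul]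
  set V := Finset.filter (fun x : Finset ℕ × Finset ℕ => x.1 ≠ x.2 ∧ ¬ Disjoint x.1 x.2)
    (sumSets s m ×ˢ sumSets s m') with hV
  set split : Finset ℕ × Finset ℕ → Σ _ : ℕ × ℕ, Finset ℕ × Finset ℕ × Finset ℕ := fun x =>
    ⟨((x.1 ∩ x.2).card, ∑ a ∈ x.1 ∩ x.2, a), (x.1 ∩ x.2, x.1 \ x.2, x.2 \ x.1)⟩ with hsplit
  have hL : ∑ S ∈ sumSets s m, ∑ T ∈ sumSets s m',
      (if S ≠ T ∧ ¬ Disjoint S T then ∏ a ∈ S ∪ T, p a else 0) = ∑ x ∈ V, g (split x) := by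
    rw [← Finset.sum_product', hV, Finset.sum_filter]
    refine Finset.sum_congr rfl fun x _ => ?_
    split_ifs with h
    · simp only [hg, hsplit]
      have e1 : (∏ a ∈ x.1 ∩ x.2, p a) * ∏ a ∈ x.1 \ x.2, p a = ∏ a ∈ x.1, p a :=
        Finset.prod_inter_mul_prod_sdiff x.1 x.2 p
      rw [← mul_assoc, e1, ← Finset.prod_union Finset.disjoint_sdiff, Finset.union_sdiff_self_eq_union]
    · rfl
  have hinj : Set.InjOn split V := by
    intro x _ y _ hxy
    simp only [hsplit, Sigma.mk.injEq, heq_eq_eq, Prod.mk.injEq] at hxy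
    obtain ⟨-, h1, h2, h3⟩ := hxy
    ext a
    · rw [← Finset.sdiff_union_inter x.1 x.2, ← Finset.sdiff_union_inter y.1 y.2, h1, h2]
    · rw [← Finset.sdiff_union_inter x.2 x.1, ← Finset.sdiff_union_inter y.2 y.1, h3,
        Finset.inter_comm, h1, Finset.inter_comm]
  have hmaps : V.image split ⊆ U := by
    intro y hy
    obtain ⟨x, hx, rfl⟩ := Finset.mem_image.1 hy
    simp only [hV, Finset.mem_filter, Finset.mem_product, mem_sumSets] at hx
    obtain ⟨⟨⟨c1, s1⟩, c2, s2⟩, hne, hnd⟩ := hx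
    have d1 := Finset.card_inter_add_card_sdiff x.1 x.2
    have d2 := Finset.card_inter_add_card_sdiff x.2 x.1
    have t1 := Finset.sum_inter_add_sum_sdiff x.1 x.2 (fun a : ℕ => a)
    have t2 := Finset.sum_inter_add_sum_sdiff x.2 x.1 (fun a : ℕ => a)
    rw [Finset.inter_comm] at d2 t2
    have hpos : 0 < (x.1 ∩ x.2).card := by
      rw [Finset.card_pos]
      rwa [Finset.disjoint_iff_inter_eq_empty, ← Ne, ← Finset.nonempty_iff_ne_empty] at hnd
    -- Both sets have `s` elements, so an intersection of size `s` would force equality.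
    have hlt : (x.1 ∩ x.2).card < s := by
      by_contra! hge
      have e1 : x.1 ∩ x.2 = x.1 := Finset.eq_of_subset_of_card_le Finset.inter_subset_left
        (by lia)
      have e2 : x.1 ∩ x.2 = x.2 := Finset.eq_of_subset_of_card_le Finset.inter_subset_right
        (by lia)
      exact hne (e1.symm.trans e2)
    simp only [hU, hI, hsplit, Finset.mem_sigma, Finset.mem_product, Finset.mem_Ico,
      Finset.mem_range, mem_sumSets]
    refine ⟨⟨⟨hpos, hlt⟩, ?_⟩, ?_, ⟨?_, ?_⟩, ?_, ?_⟩ <;> first | trivial | lia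
  rw [hR, hL, ← Finset.sum_image (f := g) hinj]
  exact Finset.sum_le_sum_of_subset_of_nonneg hmaps fun y _ _ =>
    mul_nonneg (hw _) (mul_nonneg (hw _) (hw _))

/-- With `k` common elements the three weights decay with exponents `1 - k/s`, `k/s`, `k/s`. Their
total `1 + k/s` exceeds `1 + 1/(2s)`, so a saving of `1/(2s)` survives the convolution. -/
theorem exists_sum_pairs_powerProb_le {s : ℕ} (hs : 2 ≤ s) :
    ∃ C, 0 ≤ C ∧ ∀ m m' : ℕ, ∑ S ∈ sumSets s m, ∑ T ∈ sumSets s m',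
      (if S ≠ T ∧ ¬ Disjoint S T then ∏ a ∈ S ∪ T, powerProb s a else 0) ≤
      C * ((min m m' : ℕ) + 1 : ℝ) ^ (-(1 / (s : ℝ) / 2)) := by
  obtain ⟨h0, h1, h2⟩ := inv_natCast_bounds hs
  obtain ⟨C, hC, H⟩ := exists_sumWeight_powerProb_le hs
  have hp := powerProb_nonneg s
  have hk : ∀ k : ℕ, ∃ K, 0 ≤ K ∧ (k ∈ Finset.Ico 1 s → ∀ M : ℕ,
      ∑ x ∈ Finset.HasAntidiagonal.antidiagonal M,
        ((x.1 : ℝ) + 1) ^ (-(1 - k * (1 / (s : ℝ)))) *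
          ((x.2 : ℝ) + 1) ^ (-(2 * (k * (1 / (s : ℝ))))) ≤
        K * ((M : ℝ) + 1) ^ (-(1 / (s : ℝ) / 2))) := by
    intro k
    by_cases hk : k ∈ Finset.Ico 1 s
    · rw [Finset.mem_Ico] at hk
      have k1 : 1 * (1 / (s : ℝ)) ≤ k * (1 / s) :=
        mul_le_mul_of_nonneg_right (by exact_mod_cast hk.1) h0.le
      have k2 : ((k : ℝ) + 1) * (1 / (s : ℝ)) ≤ s * (1 / s) :=
        mul_le_mul_of_nonneg_right (by exact_mod_cast hk.2) h0.le
      obtain ⟨K, hK, HK⟩ := exists_sum_rpow_mul_rpow_le (u := 1 - k * (1 / (s : ℝ)))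
        (v := 2 * (k * (1 / (s : ℝ)))) (d := 1 / (s : ℝ) / 2) (by linarith) (by linarith)
        (by linarith) (by linarith) (by linarith)
      exact ⟨K, hK, fun _ => HK⟩
    · exact ⟨0, le_rfl, fun h => absurd h hk⟩
  choose K hK HK using hk
  refine ⟨∑ k ∈ Finset.Ico 1 s, C * (C * C) * K k, Finset.sum_nonneg fun k _ => ?_,
    fun m m' => (sum_pairs_le hp s m m').trans ?_⟩
  · have := hK k
    positivity
  rw [Finset.sum_mul]
  refine Finset.sum_le_sum fun k hk => ?_
  set M := min m m' with hM
  have hk' := Finset.mem_Ico.1 hk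
  have hsk : ((s - k : ℕ) : ℝ) * (1 / (s : ℝ)) - 1 = -(k * (1 / (s : ℝ))) := by
    rw [Nat.cast_sub hk'.2.le, sub_mul, h2]
    ring
  have hbound : ∀ j ∈ Finset.range (M + 1), ∀ n : ℕ, M ≤ n →
      sumWeight (powerProb s) (s - k) (n - j) ≤
        C * (((M - j : ℕ) : ℝ) + 1) ^ (-(k * (1 / (s : ℝ)))) := by
    intro j hj n hn
    refine (H (s - k) (Nat.sub_le _ _) _).trans ?_
    rw [hsk]
    refine mul_le_mul_of_nonneg_left ?_ hC
    refine Real.rpow_le_rpow_of_nonpos (by positivity) ?_ (neg_nonpos.2 (by positivity))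
    have : M - j ≤ n - j := Nat.sub_le_sub_right hn j
    have : ((M - j : ℕ) : ℝ) ≤ (n - j : ℕ) := by exact_mod_cast this
    linarith
  have := HK k hk M
  rw [Finset.Nat.sum_antidiagonal_eq_sum_range_succ_mk] at this
  calc _ ≤ ∑ j ∈ Finset.range (M + 1), C * (C * C) *
        (((j : ℝ) + 1) ^ (-(1 - k * (1 / (s : ℝ)))) *
          (((M - j : ℕ) : ℝ) + 1) ^ (-(2 * (k * (1 / (s : ℝ)))))) := by
        refine Finset.sum_le_sum fun j hj => ?_
        have w1 := H k hk'.2.le j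
        have w2 := hbound j hj m (min_le_left _ _)
        have w3 := hbound j hj m' (min_le_right _ _)
        have hpos : (0 : ℝ) < ((M - j : ℕ) : ℝ) + 1 := by positivity
        refine (mul_le_mul w1 (mul_le_mul w2 w3 (sumWeight_nonneg hp _ _) (by positivity))
          (mul_nonneg (sumWeight_nonneg hp _ _) (sumWeight_nonneg hp _ _))
          (by positivity)).trans_eq ?_
        rw [show -(2 * ((k : ℝ) * (1 / (s : ℝ)))) = -(k * (1 / (s : ℝ))) + -(k * (1 / (s : ℝ)))
          by ring, Real.rpow_add hpos, neg_sub]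
        ring
    _ ≤ _ := by
        rw [← Finset.mul_sum, mul_assoc (C * (C * C))]
        exact mul_le_mul_of_nonneg_left this (by positivity)

end SumSets

/-! ### The probability that a finite set of targets is missed -/

section Representations

theorem isRepresentable_iff {s : ℕ} {A B : Set ℕ} {n : ℕ} :
    IsRepresentable s A B n ↔
      ∃ b ∈ B, b ≤ n ∧ ∃ S ∈ sumSets s (n - b), (S : Set ℕ) ⊆ A := by
  constructor
  · rintro ⟨a, b, ha, haA, hb, hn⟩
    refine ⟨b, hb, by lia, Finset.univ.image a, mem_sumSets.2 ⟨?_, ?_⟩, ?_⟩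
    · rw [Finset.card_image_of_injective _ ha, Finset.card_univ, Fintype.card_fin]
    · rw [Finset.sum_image fun x _ y _ h => ha h]
      lia
    · intro x hx
      obtain ⟨i, -, rfl⟩ := Finset.mem_image.1 (Finset.mem_coe.1 hx)
      exact haA i
  · rintro ⟨b, hb, hbn, S, hS, hSA⟩
    obtain ⟨hc, hsum⟩ := mem_sumSets.1 hS
    refine ⟨S.orderEmbOfFin hc, b, (S.orderEmbOfFin hc).injective,
      fun i => hSA (S.orderEmbOfFin_mem hc i), hb, ?_⟩
    have : ∑ i, S.orderEmbOfFin hc i = ∑ a ∈ S, a := by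
      rw [← Finset.sum_image (f := fun a : ℕ => a) (g := S.orderEmbOfFin hc)
        fun x _ y _ h => (S.orderEmbOfFin hc).injective h]
      congr 1
      exact Finset.coe_injective (by simp)
    lia

/-- The `s`-element sets whose sum lies in `M`. -/
def repFamily (s : ℕ) (M : Finset ℕ) : Finset (Finset ℕ) := M.biUnion (sumSets s)

theorem sum_repFamily (s : ℕ) (M : Finset ℕ) (f : Finset ℕ → ℝ) :
    ∑ S ∈ repFamily s M, f S = ∑ m ∈ M, ∑ S ∈ sumSets s m, f S := by
  refine Finset.sum_biUnion fun m _ m' _ hne => ?_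
  rw [Function.onFun, Finset.disjoint_left]
  intro S h1 h2
  exact hne ((mem_sumSets.1 h1).2.symm.trans (mem_sumSets.1 h2).2)

theorem repFamily_union (s : ℕ) (M N : Finset ℕ) :
    repFamily s (M ∪ N) = repFamily s M ∪ repFamily s N := by
  ext S
  simp only [repFamily, Finset.mem_biUnion, Finset.mem_union]
  exact ⟨fun ⟨m, h, hS⟩ => h.imp (fun h => ⟨m, h, hS⟩) fun h => ⟨m, h, hS⟩,
    fun h => h.elim (fun ⟨m, h, hS⟩ => ⟨m, .inl h, hS⟩) fun ⟨m, h, hS⟩ => ⟨m, .inr h, hS⟩⟩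

theorem exp_le_one_sub {x : ℝ} (h0 : 0 ≤ x) (h1 : x ≤ 1 / 2) :
    Real.exp (-(x + 2 * x ^ 2)) ≤ 1 - x := by
  have h2 : 0 < 1 - x := by linarith
  have h3 : (1 - x)⁻¹ ≤ Real.exp (x + 2 * x ^ 2) := by
    refine le_trans ?_ (Real.add_one_le_exp _)
    rw [inv_le_iff_one_le_mul₀ h2]
    nlinarith [mul_nonneg h0 h0, mul_nonneg (mul_nonneg h0 h0) (by linarith : 0 ≤ 1 - 2 * x)]
  rw [Real.exp_neg]
  exact inv_le_of_inv_le₀ h2 h3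

/-- Some element of `S` is at least `m/s`; its probability is small and the other factors are at
most `1`. -/
theorem exists_prod_powerProb_le {s : ℕ} (hs : 2 ≤ s) :
    ∃ C, 0 ≤ C ∧ ∀ m : ℕ, ∀ S ∈ sumSets s m,
      ∏ a ∈ S, powerProb s a ≤ C * ((m : ℝ) + 1) ^ (-(1 / (s : ℝ) / 2)) := by
  obtain ⟨h0, h1, h2⟩ := inv_natCast_bounds hs
  obtain ⟨C, hC, H⟩ := exists_forall_coeff_powerProbSeries_pow_le hs
  have hs0 : (0 : ℝ) < s := by positivity
  refine ⟨C * s ^ (1 / (s : ℝ) / 2), by positivity, fun m S hS => ?_⟩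
  obtain ⟨hc, hsum⟩ := mem_sumSets.1 hS
  have hne : S.Nonempty := Finset.card_pos.1 (by lia)
  obtain ⟨a, haS, ha⟩ : ∃ a ∈ S, m ≤ s * a := by
    by_contra! h
    have := Finset.sum_lt_sum_of_nonempty hne h
    rw [← Finset.mul_sum, hsum, Finset.sum_const, hc, smul_eq_mul] at this
    exact lt_irrefl _ this
  have hHa := H 1 (by lia) a
  rw [pow_one, powerProbSeries, PowerSeries.coeff_mk, Nat.cast_one, one_mul] at hHa
  have h3 : ∏ b ∈ S, powerProb s b ≤ powerProb s a := by
    rw [← Finset.mul_prod_erase S _ haS]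
    refine mul_le_of_le_one_right (powerProb_nonneg s a) ?_
    exact Finset.prod_le_one (fun b _ => powerProb_nonneg s b) fun b _ =>
      (powerProb_le_half hs b).trans (by norm_num)
  have h4 : ((a : ℝ) + 1) ^ (1 / (s : ℝ) - 1) ≤ ((a : ℝ) + 1) ^ (-(1 / (s : ℝ) / 2)) :=
    Real.rpow_le_rpow_of_exponent_le (by linarith [(Nat.cast_nonneg a : (0 : ℝ) ≤ a)])
      (by linarith)
  have hsa : (m : ℝ) + 1 ≤ s * (a + 1) := by
    have : (m : ℝ) ≤ s * a := by exact_mod_cast ha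
    have : (1 : ℝ) ≤ s := by exact_mod_cast (by lia : 1 ≤ s)
    linarith
  have h5 : ((s : ℝ) * (a + 1)) ^ (-(1 / (s : ℝ) / 2)) ≤
      ((m : ℝ) + 1) ^ (-(1 / (s : ℝ) / 2)) :=
    Real.rpow_le_rpow_of_nonpos (by positivity) hsa (by linarith)
  calc _ ≤ C * ((a : ℝ) + 1) ^ (-(1 / (s : ℝ) / 2)) :=
        (h3.trans hHa).trans (mul_le_mul_of_nonneg_left h4 hC)
    _ = C * (s ^ (1 / (s : ℝ) / 2) * ((s : ℝ) * (a + 1)) ^ (-(1 / (s : ℝ) / 2))) := by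
        rw [Real.mul_rpow hs0.le (by positivity), ← mul_assoc ((s : ℝ) ^ _), ← Real.rpow_add hs0]
        simp
    _ ≤ _ := by
        rw [mul_assoc]
        gcongr

variable {Ω : Type*} [MeasurableSpace Ω] {P : Measure Ω} {A : Ω → Set ℕ}

theorem IsPseudoPowers.measureReal_mem {s : ℕ} (hs : 2 ≤ s) (hA : IsPseudoPowers s P A) (n : ℕ) :
    P.real {ω | n ∈ A ω} = powerProb s n := by
  rcases eq_or_ne n 0 with rfl | hn
  · have : {ω | 0 ∈ A ω} = ∅ := Set.eq_empty_of_forall_notMem hA.zero_notMem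
    rw [this, powerProb_zero hs, measureReal_empty]
  · rw [Measure.real, hA.prob_mem n (by lia)]
    exact ENNReal.toReal_ofReal (powerProb_nonneg s n)

theorem IsPseudoPowers.measureReal_hitEvent {s : ℕ} (hs : 2 ≤ s) (hA : IsPseudoPowers s P A)
    (S : Finset ℕ) : P.real (hitEvent A S) = ∏ a ∈ S, powerProb s a := by
  rw [_root_.measureReal_hitEvent hA.indep]
  exact Finset.prod_congr rfl fun a _ => hA.measureReal_mem hs a

variable [IsProbabilityMeasure P]

/-- The probability that no element of `M` is a sum of `s` distinct pseudo `s`-th powers. -/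
theorem IsPseudoPowers.exists_measureReal_avoidEvent_bounds {s : ℕ} (hs : 2 ≤ s)
    (hA : IsPseudoPowers s P A) :
    ∃ C, 0 ≤ C ∧ ∀ (L : ℕ) (M : Finset ℕ), (∀ m ∈ M, L ≤ m) →
      Real.exp (-(lambdaConst s * M.card) -
        C * (M.card : ℝ) ^ 2 * ((L : ℝ) + 1) ^ (-(1 / (s : ℝ) / 2))) ≤
        P.real (avoidEvent A (repFamily s M)) ∧
      P.real (avoidEvent A (repFamily s M)) ≤ Real.exp (-(lambdaConst s * M.card) +
        C * (M.card : ℝ) ^ 2 * ((L : ℝ) + 1) ^ (-(1 / (s : ℝ) / 2))) := by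
  obtain ⟨h0, h1, h2⟩ := inv_natCast_bounds hs
  obtain ⟨C₁, hC₁, H₁⟩ := exists_abs_sumWeight_sub_le hs
  obtain ⟨C₂, hC₂, H₂⟩ := exists_sum_pairs_powerProb_le hs
  obtain ⟨C₃, hC₃, H₃⟩ := exists_prod_powerProb_le hs
  have hlam := lambdaConst_pos hs
  -- `C₁` accounts for the mean, `C₂` for the Janson sum, and the last term for the squares in `1 -
  -- x ≥ exp(-x - 2x²)`.
  refine ⟨C₁ + C₂ + 2 * (C₃ * (lambdaConst s + C₁)), by positivity, fun L M hM => ?_⟩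
  set e := ((L : ℝ) + 1) ^ (-(1 / (s : ℝ) / 2)) with he
  have he0 : 0 < e := by positivity
  have hanti : ∀ m : ℕ, L ≤ m → ((m : ℝ) + 1) ^ (-(1 / (s : ℝ) / 2)) ≤ e := by
    intro m hm
    refine Real.rpow_le_rpow_of_nonpos (by positivity) ?_ (by linarith)
    have : (L : ℝ) ≤ m := by exact_mod_cast hm
    linarith
  have he1 : e ≤ 1 := Real.rpow_le_one_of_one_le_of_nonpos
    (by linarith [(Nat.cast_nonneg L : (0 : ℝ) ≤ L)]) (by linarith)
  have hcard : (M.card : ℝ) ≤ (M.card : ℝ) ^ 2 := by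
    exact_mod_cast Nat.le_self_pow two_ne_zero _
  have hW : ∀ m ∈ M, |sumWeight (powerProb s) s m - lambdaConst s| ≤ C₁ * e := fun m hm =>
    (H₁ m).trans (mul_le_mul_of_nonneg_left (hanti m (hM m hm)) hC₁)
  have hmu : ∑ S ∈ repFamily s M, P.real (hitEvent A S) =
      ∑ m ∈ M, sumWeight (powerProb s) s m := by
    rw [sum_repFamily]
    refine Finset.sum_congr rfl fun m _ => Finset.sum_congr rfl fun S _ => ?_
    rw [hA.measureReal_hitEvent hs]
  have hmu_lo : lambdaConst s * M.card - C₁ * M.card * e ≤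
      ∑ m ∈ M, sumWeight (powerProb s) s m := by
    calc _ = ∑ m ∈ M, (lambdaConst s - C₁ * e) := by
          rw [Finset.sum_const, nsmul_eq_mul]
          ring
      _ ≤ _ := Finset.sum_le_sum fun m hm => by linarith [(abs_le.1 (hW m hm)).1]
  have hmu_up : ∑ m ∈ M, sumWeight (powerProb s) s m ≤
      lambdaConst s * M.card + C₁ * M.card * e := by
    calc _ ≤ ∑ m ∈ M, (lambdaConst s + C₁ * e) :=
          Finset.sum_le_sum fun m hm => by linarith [(abs_le.1 (hW m hm)).2]
      _ = _ := by
          rw [Finset.sum_const, nsmul_eq_mul]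
          ring
  have hce : (M.card : ℝ) * e ≤ (M.card : ℝ) ^ 2 * e := mul_le_mul_of_nonneg_right hcard he0.le
  have hce1 := mul_le_mul_of_nonneg_left hce hC₁
  have hQ0 : 0 ≤ (M.card : ℝ) ^ 2 * e := by positivity
  have hQ2 := mul_nonneg hC₂ hQ0
  have hQ3 : 0 ≤ C₃ * (lambdaConst s + C₁) * ((M.card : ℝ) ^ 2 * e) := by positivity
  constructor
  · have hhalf : ∀ m, ∀ S ∈ sumSets s m, ∏ a ∈ S, powerProb s a ≤ 1 / 2 := by
      intro m S hS
      obtain ⟨a, ha⟩ := Finset.card_pos.1 (by rw [(mem_sumSets.1 hS).1]; lia : 0 < S.card)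
      rw [← Finset.mul_prod_erase S _ ha]
      refine (mul_le_of_le_one_right (powerProb_nonneg s a) ?_).trans (powerProb_le_half hs a)
      exact Finset.prod_le_one (fun b _ => powerProb_nonneg s b) fun b _ =>
        (powerProb_le_half hs b).trans (by norm_num)
    have hw0 : ∀ S : Finset ℕ, 0 ≤ ∏ a ∈ S, powerProb s a := fun S =>
      Finset.prod_nonneg fun a _ => powerProb_nonneg s a
    -- The sum of squares is at most the largest weight times the sum of the weights.
    have hsq : ∑ S ∈ repFamily s M, (∏ a ∈ S, powerProb s a) ^ 2 ≤
        C₃ * (lambdaConst s + C₁) * ((M.card : ℝ) * e) := by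
      rw [sum_repFamily]
      calc _ ≤ ∑ m ∈ M, C₃ * e * (lambdaConst s + C₁) := by
            refine Finset.sum_le_sum fun m hm => ?_
            calc _ ≤ ∑ S ∈ sumSets s m, C₃ * e * ∏ a ∈ S, powerProb s a := by
                  refine Finset.sum_le_sum fun S hS => ?_
                  rw [sq]
                  refine mul_le_mul_of_nonneg_right ?_ (hw0 S)
                  exact (H₃ m S hS).trans (mul_le_mul_of_nonneg_left (hanti m (hM m hm)) hC₃)
              _ = C₃ * e * sumWeight (powerProb s) s m := by rw [← Finset.mul_sum, sumWeight]
              _ ≤ _ := by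
                  refine mul_le_mul_of_nonneg_left ?_ (by positivity)
                  have := (abs_le.1 (hW m hm)).2
                  have := mul_le_mul_of_nonneg_left he1 hC₁
                  linarith
        _ = _ := by
            rw [Finset.sum_const, nsmul_eq_mul]
            ring
    refine le_trans ?_ (prod_one_sub_le_measureReal_avoidEvent hA.measurableSet_mem hA.indep _)
    calc _ ≤ Real.exp (∑ S ∈ repFamily s M, -(P.real (hitEvent A S) +
          2 * P.real (hitEvent A S) ^ 2)) := by
          refine Real.exp_le_exp.2 ?_
          rw [Finset.sum_neg_distrib, Finset.sum_add_distrib, ← Finset.mul_sum, hmu]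
          simp only [hA.measureReal_hitEvent hs]
          have := mul_le_mul_of_nonneg_left hce
            (by positivity : 0 ≤ C₃ * (lambdaConst s + C₁))
          linarith
      _ = ∏ S ∈ repFamily s M, Real.exp (-(P.real (hitEvent A S) +
          2 * P.real (hitEvent A S) ^ 2)) := Real.exp_sum _ _
      _ ≤ _ := by
          refine Finset.prod_le_prod (fun _ _ => (Real.exp_pos _).le) fun S hS => ?_
          obtain ⟨m, -, hS⟩ := Finset.mem_biUnion.1 hS
          refine exp_le_one_sub measureReal_nonneg ?_
          rw [hA.measureReal_hitEvent hs]
          exact hhalf m S hS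
  · refine (measureReal_avoidEvent_le_exp hA.measurableSet_mem hA.indep _).trans
      (Real.exp_le_exp.2 ?_)
    have hJ : janson P A (repFamily s M) ≤ C₂ * ((M.card : ℝ) ^ 2 * e) := by
      have hrw : janson P A (repFamily s M) = ∑ m ∈ M, ∑ m' ∈ M,
          ∑ S ∈ sumSets s m, ∑ T ∈ sumSets s m',
            (if S ≠ T ∧ ¬ Disjoint S T then ∏ a ∈ S ∪ T, powerProb s a else 0) := by
        unfold janson
        rw [sum_repFamily]
        refine Finset.sum_congr rfl fun m _ => ?_
        rw [Finset.sum_comm (s := M)]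
        refine Finset.sum_congr rfl fun S _ => ?_
        rw [sum_repFamily]
        refine Finset.sum_congr rfl fun m' _ => Finset.sum_congr rfl fun T _ => ?_
        rw [hA.measureReal_hitEvent hs]
      rw [hrw]
      calc _ ≤ ∑ m ∈ M, ∑ m' ∈ M, C₂ * e := by
            refine Finset.sum_le_sum fun m hm => Finset.sum_le_sum fun m' hm' => ?_
            exact (H₂ m m').trans (mul_le_mul_of_nonneg_left
              (hanti _ (le_min (hM m hm) (hM m' hm'))) hC₂)
        _ = _ := by
            simp only [Finset.sum_const, nsmul_eq_mul]
            ring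
    rw [hmu]
    linarith

end Representations

/-! ### Counting functions of logarithmic size and summability -/

section CountingFunctions

open Classical in
theorem countingFn_eq_card (B : Set ℕ) (n : ℕ) :
    countingFn B n = ((Finset.Icc 1 n).filter (· ∈ B)).card := by
  rw [countingFn, ← Set.ncard_coe_finset]
  congr 1
  ext x
  simp only [Set.mem_inter_iff, Set.mem_Icc, Finset.mem_coe, Finset.mem_filter, Finset.mem_Icc]
  tauto

theorem countingFn_mono (B : Set ℕ) : Monotone (countingFn B) := fun _ n h =>
  Set.ncard_le_ncard (Set.inter_subset_inter_right B (Set.Icc_subset_Icc_right h))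
    ((Set.finite_Icc 1 n).subset Set.inter_subset_right)

theorem tendsto_log_natCast : Tendsto (fun n : ℕ => Real.log n) atTop atTop :=
  Real.tendsto_log_atTop.comp tendsto_natCast_atTop_atTop

theorem isLittleO_log_log :
    (fun n : ℕ => Real.log (Real.log n)) =o[atTop] fun n : ℕ => Real.log n :=
  Real.isLittleO_log_id_atTop.comp_tendsto tendsto_log_natCast

theorem HasCountingFn.tendsto_div_log {B : Set ℕ} {c : ℝ} {f g : ℕ → ℝ} (hB : HasCountingFn B f)
    (hg : g =o[atTop] fun n : ℕ => Real.log n) (hf : ∀ n : ℕ, f n = c * Real.log n + g n) :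
    Tendsto (fun n : ℕ => (countingFn B n : ℝ) / Real.log n) atTop (nhds c) := by
  have hlog := tendsto_log_natCast
  have h1 : Tendsto (fun n => c + g n / Real.log n) atTop (nhds c) := by
    simpa using tendsto_const_nhds.add hg.tendsto_div_nhds_zero
  have h2 : Tendsto (fun n : ℕ => c + g n / Real.log n - (Real.log n)⁻¹) atTop (nhds c) := by
    simpa using h1.sub hlog.inv_tendsto_atTop
  have key : ∀ᶠ n : ℕ in atTop, 0 < Real.log n ∧ (countingFn B n : ℝ) ≤ f n ∧
      f n ≤ countingFn B n + 1 := by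
    filter_upwards [hlog.eventually_gt_atTop 0, hB] with n h0 hn
    have e : (countingFn B n : ℝ) = ⌊f n⌋ := by exact_mod_cast hn
    rw [e]
    exact ⟨h0, Int.floor_le _, (Int.lt_floor_add_one _).le⟩
  refine tendsto_of_tendsto_of_tendsto_of_le_of_le' h2 h1 ?_ ?_
  · filter_upwards [key] with n hn
    obtain ⟨h0, -, h2⟩ := hn
    rw [le_div_iff₀ h0]
    field_simp
    linarith [hf n]
  · filter_upwards [key] with n hn
    obtain ⟨h0, h1, -⟩ := hn
    rw [div_le_iff₀ h0]
    field_simp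
    linarith [hf n]

theorem atThreshold_of_tendsto {s : ℕ} {B : Set ℕ}
    (h : Tendsto (fun n : ℕ => (countingFn B n : ℝ) / Real.log n) atTop
      (nhds (lambdaConst s)⁻¹)) : AtThreshold s B :=
  ((continuous_coe_real_ereal.tendsto _).comp h).liminf_eq

theorem eventually_countingFn_le {B : Set ℕ} {c : ℝ} (hc : 0 < c)
    (h : Tendsto (fun n : ℕ => (countingFn B n : ℝ) / Real.log n) atTop (nhds c)) :
    ∀ᶠ n : ℕ in atTop, (countingFn B n : ℝ) ≤ 2 * c * Real.log n := by
  filter_upwards [h.eventually_le_const (by linarith : c < 2 * c),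
    tendsto_log_natCast.eventually_gt_atTop 0] with n h1 h0
  rwa [div_le_iff₀ h0] at h1

/-- Beyond a threshold `N`, put `n` in `B` exactly when `⌊f⌋` jumps at `n`, necessarily by `1`. An
initial block of length `⌊f N⌋ ≤ N` gives the right starting count. -/
theorem exists_hasCountingFn {f : ℕ → ℝ} (hmono : ∀ᶠ n in atTop, f n ≤ f (n + 1))
    (hstep : ∀ᶠ n in atTop, f (n + 1) ≤ f n + 1) (hpos : ∀ᶠ n in atTop, 0 ≤ f n)
    (hle : ∀ᶠ n : ℕ in atTop, f n ≤ n) : ∃ B : Set ℕ, HasCountingFn B f := by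
  classical
  obtain ⟨N, hN⟩ := eventually_atTop.1 (hmono.and (hstep.and (hpos.and hle)))
  obtain ⟨B, hB⟩ : ∃ B : Set ℕ,
    B = {n | (n ≤ N ∧ (n : ℤ) ≤ ⌊f N⌋) ∨ (N < n ∧ ⌊f n⌋ ≠ ⌊f (n - 1)⌋)} := ⟨_, rfl⟩
  refine ⟨B, eventually_atTop.2 ⟨N, fun n hn => ?_⟩⟩
  induction n, hn using Nat.le_induction with
  | base =>
    have h0 : 0 ≤ ⌊f N⌋ := Int.floor_nonneg.2 (hN N le_rfl).2.2.1
    have h1 : ⌊f N⌋ ≤ N := by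
      have := (Int.floor_le (f N)).trans (hN N le_rfl).2.2.2
      exact_mod_cast this
    have : (Finset.Icc 1 N).filter (· ∈ B) = Finset.Icc 1 ⌊f N⌋.toNat := by
      ext x
      simp only [hB, Finset.mem_filter, Finset.mem_Icc, Set.mem_ofPred_eq]
      lia
    rw [countingFn_eq_card, this, Nat.card_Icc]
    lia
  | succ n hn ih =>
    obtain ⟨h1, h2, -, -⟩ := hN n hn
    have e1 : ⌊f n⌋ ≤ ⌊f (n + 1)⌋ := Int.floor_le_floor h1
    have e2 : ⌊f (n + 1)⌋ ≤ ⌊f n⌋ + 1 := by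
      have := Int.floor_le_floor h2
      rwa [Int.floor_add_one] at this
    have hins : Finset.Icc 1 (n + 1) = insert (n + 1) (Finset.Icc 1 n) := by
      ext x
      simp only [Finset.mem_insert, Finset.mem_Icc]
      lia
    have hmem : n + 1 ∈ B ↔ ⌊f (n + 1)⌋ ≠ ⌊f n⌋ := by
      simp only [hB, Set.mem_ofPred_eq, Nat.add_sub_cancel]
      constructor
      · rintro (⟨h, -⟩ | ⟨-, h⟩)
        · lia
        · exact h
      · exact fun h => .inr ⟨by lia, h⟩
    rw [countingFn_eq_card] at ih ⊢
    rw [hins, Finset.filter_insert]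
    split_ifs with h
    · rw [Finset.card_insert_of_notMem (by simp)]
      have := hmem.1 h
      push_cast
      lia
    · rw [hmem, not_not] at h
      rw [ih, h]

/-- If `d` is the increment of `log`, that of `log log` is at most `d / log n`. The total increment
thus lies between `0` and `2ad ≤ 2a/n` eventually, whatever the sign of `b`. -/
theorem exists_hasCountingFn_log_add_log_log {a : ℝ} (ha : 0 < a) (b : ℝ) :
    ∃ B : Set ℕ, HasCountingFn B fun n => a * Real.log n + b * Real.log (Real.log n) := by
  have hlog := tendsto_log_natCast
  have hb : Tendsto (fun n : ℕ => |b| / Real.log n) atTop (nhds 0) :=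
    tendsto_const_nhds.div_atTop hlog
  have hd : ∀ᶠ n : ℕ in atTop, ∃ d e : ℝ, 0 ≤ d ∧ d ≤ 1 / n ∧ |e| ≤ d * (|b| / Real.log n) ∧
      a * Real.log (n + 1 : ℕ) + b * Real.log (Real.log (n + 1 : ℕ)) =
        a * Real.log n + b * Real.log (Real.log n) + a * d + e := by
    filter_upwards [hlog.eventually_gt_atTop 0, eventually_gt_atTop 0] with n h0 hn
    have hn' : (0 : ℝ) < n := by exact_mod_cast hn
    have h1 : Real.log n ≤ Real.log (n + 1 : ℕ) :=
      Real.log_le_log hn' (by push_cast; linarith)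
    have h2 : Real.log (n + 1 : ℕ) - Real.log n ≤ 1 / n := by
      rw [← Real.log_div (by positivity) (by positivity)]
      refine (Real.log_le_sub_one_of_pos (by positivity)).trans_eq ?_
      push_cast
      field_simp
      ring
    have h3 : Real.log (Real.log n) ≤ Real.log (Real.log (n + 1 : ℕ)) := Real.log_le_log h0 h1
    have h4 : Real.log (Real.log (n + 1 : ℕ)) - Real.log (Real.log n) ≤
        (Real.log (n + 1 : ℕ) - Real.log n) / Real.log n := by
      rw [← Real.log_div (by linarith) h0.ne']
      refine (Real.log_le_sub_one_of_pos (div_pos (by linarith) h0)).trans_eq ?_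
      field_simp
    refine ⟨Real.log (n + 1 : ℕ) - Real.log n,
      b * (Real.log (Real.log (n + 1 : ℕ)) - Real.log (Real.log n)), by linarith, h2, ?_, by ring⟩
    rw [abs_mul, abs_of_nonneg (by linarith : 0 ≤ Real.log (Real.log (n + 1 : ℕ)) -
      Real.log (Real.log n))]
    refine (mul_le_mul_of_nonneg_left h4 (abs_nonneg b)).trans_eq ?_
    ring
  refine exists_hasCountingFn ?_ ?_ ?_ ?_
  · filter_upwards [hd, hb.eventually_le_const ha] with n ⟨d, e, h0, _, h2, h3⟩ h4
    have := mul_le_mul_of_nonneg_left h4 h0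
    linarith [(abs_le.1 h2).1]
  · have hinv : Tendsto (fun n : ℕ => (2 * a) * (1 / (n : ℝ))) atTop (nhds 0) := by
      simpa using tendsto_one_div_atTop_nhds_zero_nat.const_mul (2 * a)
    filter_upwards [hd, hb.eventually_le_const ha, hinv.eventually_le_const one_pos]
      with n ⟨d, e, h0, h1, h2, h3⟩ h4 h5
    have h6 := mul_le_mul_of_nonneg_left h4 h0
    have h7 := mul_le_mul_of_nonneg_left h1 (by positivity : 0 ≤ 2 * a)
    linarith [(abs_le.1 h2).2]
  · filter_upwards [(isLittleO_log_log.const_mul_left b).bound ha,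
      hlog.eventually_gt_atTop 0] with n h1 h0
    rw [Real.norm_eq_abs, Real.norm_eq_abs, abs_of_pos h0] at h1
    linarith [(abs_le.1 h1).1]
  · have h1 : (fun n : ℕ => a * Real.log n + b * Real.log (Real.log n)) =o[atTop]
        fun n : ℕ => (n : ℝ) := by
      have h2 : (fun n : ℕ => Real.log n) =o[atTop] fun n : ℕ => (n : ℝ) :=
        Real.isLittleO_log_id_atTop.comp_tendsto tendsto_natCast_atTop_atTop
      exact (h2.const_mul_left a).add ((isLittleO_log_log.trans h2).const_mul_left b)
    filter_upwards [h1.bound one_pos] with n hn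
    rw [one_mul, Real.norm_eq_abs, Real.norm_eq_abs, Nat.abs_cast] at hn
    exact (le_abs_self _).trans hn

theorem tendsto_log_sq_mul_rpow_neg {d : ℝ} (hd : 0 < d) :
    Tendsto (fun n : ℕ => Real.log n ^ 2 * (n : ℝ) ^ (-d)) atTop (nhds 0) := by
  have h := (isLittleO_log_rpow_atTop (r := d / 2) (by positivity)).comp_tendsto
    (tendsto_natCast_atTop_atTop (R := ℝ))
  have h2 := (h.tendsto_div_nhds_zero).pow 2
  rw [zero_pow two_ne_zero] at h2
  refine h2.congr fun n => ?_
  simp only [Function.comp]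
  rw [div_pow, ← Real.rpow_natCast ((n : ℝ) ^ _), ← Real.rpow_mul (Nat.cast_nonneg n),
    Real.rpow_neg (Nat.cast_nonneg n), div_eq_mul_inv]
  push_cast
  norm_num

/-- Cauchy condensation reduces this to `∑ 1/k²`. -/
theorem summable_inv_mul_log_sq :
    Summable fun n : ℕ => ((n : ℝ) * Real.log n ^ 2)⁻¹ := by
  have hnn : ∀ n : ℕ, 0 ≤ ((n : ℝ) * Real.log n ^ 2)⁻¹ := fun n => by positivity
  refine (summable_condensed_iff_of_eventually_nonneg (Eventually.of_forall hnn) ?_).1 ?_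
  · filter_upwards [eventually_ge_atTop 2] with n hn
    have hn' : (2 : ℝ) ≤ n := by exact_mod_cast hn
    have h0 : 0 < Real.log n := Real.log_pos (by linarith)
    have h1 : Real.log n ≤ Real.log (n + 1 : ℕ) :=
      Real.log_le_log (by linarith) (by push_cast; linarith)
    refine inv_anti₀ (by positivity) ?_
    gcongr
    lia
  · have h := (Real.summable_nat_pow_inv (p := 2)).2 one_lt_two |>.mul_left (Real.log 2 ^ 2)⁻¹
    refine h.congr fun k => ?_
    push_cast
    rw [Real.log_pow, mul_inv, ← mul_assoc, mul_inv_cancel₀ (by positivity), one_mul, mul_pow,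
      mul_inv]
    ring

theorem summable_comp_div_two {g : ℕ → ℝ} (hg : Summable g) : Summable fun n => g (n / 2) := by
  refine (HasSum.even_add_odd (m := ∑' n, g n) (m' := ∑' n, g n) ?_ ?_).summable
  · simpa using hg.hasSum
  · convert hg.hasSum using 3
    lia

end CountingFunctions

/-! ### The first example: Borel–Cantelli -/

section Complement

variable {Ω : Type*} {A : Ω → Set ℕ}

-- Only the `b ∈ [1, n/2]` are used, so every target `n - b` is at least `n/2`. Since `log (n/2)`
-- and `log n` differ by a bounded amount, this costs only a constant factor in the probability.
open Classical in
theorem exists_finset_sub_near (s : ℕ) (B : Set ℕ) (n : ℕ) : ∃ M : Finset ℕ,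
    M.card = countingFn B (n / 2) ∧ (∀ m ∈ M, n / 2 ≤ m) ∧
    ∀ ω, ¬ IsRepresentable s (A ω) B n → ω ∈ avoidEvent A (repFamily s M) := by
  refine ⟨((Finset.Icc 1 (n / 2)).filter (· ∈ B)).image (n - ·), ?_, ?_, fun ω hω S hS hSA => ?_⟩
  · rw [countingFn_eq_card, Finset.card_image_of_injOn]
    intro x hx y hy hxy
    simp only [Finset.coe_filter, Finset.mem_Icc, Set.mem_ofPred_eq] at hx hy hxy
    lia
  · intro m hm
    obtain ⟨b, hb, rfl⟩ := Finset.mem_image.1 hm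
    rw [Finset.mem_filter, Finset.mem_Icc] at hb
    lia
  · obtain ⟨m, hm, hS⟩ := Finset.mem_biUnion.1 hS
    obtain ⟨b, hb, rfl⟩ := Finset.mem_image.1 hm
    rw [Finset.mem_filter, Finset.mem_Icc] at hb
    exact hω (isRepresentable_iff.2 ⟨b, hb.2, by lia, S, hS, hSA⟩)

variable [MeasurableSpace Ω] {P : Measure Ω} [IsProbabilityMeasure P]

theorem IsPseudoPowers.almostSurelyComplement {s : ℕ} (hs : 2 ≤ s) (hA : IsPseudoPowers s P A)
    {B : Set ℕ} (hB : HasCountingFn B fun n => (lambdaConst s)⁻¹ * Real.log n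
      + 2 * (lambdaConst s)⁻¹ * Real.log (Real.log n)) : AlmostSurelyComplement s P A B := by
  obtain ⟨C, hC, H⟩ := hA.exists_measureReal_avoidEvent_bounds hs
  have hlam := lambdaConst_pos hs
  obtain ⟨h0, -, -⟩ := inv_natCast_bounds hs
  set lam := lambdaConst s with hlam_def
  set d := 1 / (s : ℝ) / 2 with hd
  have hd0 : 0 < d := by positivity
  choose M hMcard hMge hMrep using exists_finset_sub_near (A := A) s B
  have hlim := hB.tendsto_div_log (c := lam⁻¹) (isLittleO_log_log.const_mul_left (2 * lam⁻¹))
    fun n => rfl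
  have hsmall : ∀ᶠ h : ℕ in atTop,
      C * (2 * lam⁻¹) ^ 2 * (Real.log h ^ 2 * (h : ℝ) ^ (-d)) ≤ 1 := by
    have := (tendsto_log_sq_mul_rpow_neg hd0).const_mul (C * (2 * lam⁻¹) ^ 2)
    rw [mul_zero] at this
    exact this.eventually_le_const one_pos
  -- In `exp (1 + lam)`, the `1` covers the Janson and mean errors and `lam` the rounding by the
  -- floor. The term `2 λ_s⁻¹ log log` of the counting function supplies `log²`.
  have hbound : ∀ᶠ h : ℕ in atTop, ∀ n, n / 2 = h →
      P.real (avoidEvent A (repFamily s (M n))) ≤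
        Real.exp (1 + lam) * ((h : ℝ) * Real.log h ^ 2)⁻¹ := by
    filter_upwards [hsmall, hB, eventually_countingFn_le (inv_pos.2 hlam) hlim,
      tendsto_log_natCast.eventually_gt_atTop 0, eventually_gt_atTop 0]
      with h h1 h2 h3 h4 h5 n hn
    have h5' : (0 : ℝ) < h := by exact_mod_cast h5
    have hup := (H (n / 2) (M n) (hMge n)).2
    rw [hMcard, hn] at hup
    set K : ℝ := (countingFn B h : ℝ) with hK
    have hK0 : 0 ≤ K := Nat.cast_nonneg _
    have hKlo : lam⁻¹ * Real.log h + 2 * lam⁻¹ * Real.log (Real.log h) ≤ K + 1 := by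
      have e : K = ⌊lam⁻¹ * Real.log h + 2 * lam⁻¹ * Real.log (Real.log h)⌋ := by
        rw [hK]
        exact_mod_cast h2
      rw [e]
      exact (Int.lt_floor_add_one _).le
    have herr : C * K ^ 2 * ((h : ℝ) + 1) ^ (-d) ≤ 1 := by
      refine le_trans ?_ h1
      have e1 : K ^ 2 ≤ (2 * lam⁻¹ * Real.log h) ^ 2 := pow_le_pow_left₀ hK0 h3 2
      have e2 : ((h : ℝ) + 1) ^ (-d) ≤ (h : ℝ) ^ (-d) :=
        Real.rpow_le_rpow_of_nonpos h5' (by linarith) (by linarith)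
      calc _ ≤ C * (2 * lam⁻¹ * Real.log h) ^ 2 * (h : ℝ) ^ (-d) := by gcongr
        _ = _ := by ring
    have hmul : Real.log h + 2 * Real.log (Real.log h) ≤ lam * (K + 1) := by
      have := mul_le_mul_of_nonneg_left hKlo hlam.le
      refine le_trans (le_of_eq ?_) this
      field_simp
    refine hup.trans ?_
    have hexp : ((h : ℝ) * Real.log h ^ 2)⁻¹ =
        Real.exp (-(Real.log h + 2 * Real.log (Real.log h))) := by
      rw [Real.exp_neg, Real.exp_add, Real.exp_log h5', two_mul, Real.exp_add, Real.exp_log h4, sq]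
    rw [hexp, ← Real.exp_add]
    exact Real.exp_le_exp.2 (by linarith)
  have hsum : Summable fun n => P.real (avoidEvent A (repFamily s (M n))) := by
    refine Summable.of_norm_bounded_eventually_nat
      ((summable_comp_div_two summable_inv_mul_log_sq).mul_left (Real.exp (1 + lam))) ?_
    obtain ⟨N, hN⟩ := eventually_atTop.1 hbound
    filter_upwards [eventually_ge_atTop (2 * N)] with n hn
    rw [Real.norm_of_nonneg measureReal_nonneg]
    exact hN (n / 2) (by lia) n rfl
  have hne : ∑' n, P (avoidEvent A (repFamily s (M n))) ≠ ⊤ := by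
    have := hsum.tsum_ofReal_ne_top
    simpa only [ofReal_measureReal (measure_ne_top P _)] using this
  filter_upwards [ae_eventually_notMem hne] with ω hω
  filter_upwards [hω] with n hn
  by_contra h
  exact hn (hMrep n ω h)

end Complement

/-! ### Sparser sets: the second moment method -/

section NotComplement

variable {Ω : Type*} {A : Ω → Set ℕ}

open Classical in
/-- The elements of `B` in `[0, n]`. -/
noncomputable def initialSegment (B : Set ℕ) (n : ℕ) : Finset ℕ :=
  (Finset.range (n + 1)).filter (· ∈ B)

theorem mem_initialSegment {B : Set ℕ} {n b : ℕ} : b ∈ initialSegment B n ↔ b ≤ n ∧ b ∈ B := by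
  simp [initialSegment]

/-- The `+ 1` allows for `0 ∈ B`, which the counting function ignores. -/
theorem card_initialSegment_le (B : Set ℕ) (n : ℕ) :
    (initialSegment B n).card ≤ countingFn B n + 1 := by
  classical
  rw [countingFn_eq_card]
  refine (Finset.card_le_card ?_).trans (Finset.card_insert_le 0 _)
  intro x hx
  rw [mem_initialSegment] at hx
  rw [Finset.mem_insert, Finset.mem_filter, Finset.mem_Icc]
  by_cases h : x = 0
  · exact .inl h
  · exact .inr ⟨⟨by lia, hx.1⟩, hx.2⟩

/-- The numbers `n - b` with `b ∈ B` and `b ≤ n`. -/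
noncomputable def differences (B : Set ℕ) (n : ℕ) : Finset ℕ := (initialSegment B n).image (n - ·)

theorem mem_differences {B : Set ℕ} {n m : ℕ} :
    m ∈ differences B n ↔ ∃ b ∈ B, b ≤ n ∧ n - b = m := by
  simp only [differences, Finset.mem_image, mem_initialSegment]
  exact ⟨fun ⟨b, h, e⟩ => ⟨b, h.2, h.1, e⟩, fun ⟨b, h, h', e⟩ => ⟨b, ⟨h', h⟩, e⟩⟩

theorem card_differences_le (B : Set ℕ) (n : ℕ) :
    (differences B n).card ≤ countingFn B n + 1 :=
  Finset.card_image_le.trans (card_initialSegment_le B n)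

theorem mem_avoidEvent_differences_iff {s : ℕ} {B : Set ℕ} {n : ℕ} {ω : Ω} :
    ω ∈ avoidEvent A (repFamily s (differences B n)) ↔ ¬ IsRepresentable s (A ω) B n := by
  rw [isRepresentable_iff]
  constructor
  · rintro h ⟨b, hb, hbn, S, hS, hSA⟩
    exact h S (Finset.mem_biUnion.2 ⟨n - b, mem_differences.2 ⟨b, hb, hbn, rfl⟩, hS⟩) hSA
  · intro h S hS hSA
    obtain ⟨m, hm, hS⟩ := Finset.mem_biUnion.1 hS
    obtain ⟨b, hb, hbn, rfl⟩ := mem_differences.1 hm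
    exact h ⟨b, hb, hbn, S, hS, hSA⟩

open Classical in
/-- The integers in `[N, 2N]` that exceed every smaller element of `B` by at least `√N`. -/
noncomputable def isolatedIntegers (B : Set ℕ) (N : ℕ) : Finset ℕ :=
  (Finset.Icc N (2 * N)).filter fun n => ∀ m ∈ differences B n, Nat.sqrt N ≤ m

/-- A discarded `n` lies in `[b, b + √N)` for some `b ∈ B` with `b ≤ 2N`, and these few intervals
are short. -/
theorem lt_card_isolatedIntegers_add (B : Set ℕ) (N : ℕ) :
    N < (isolatedIntegers B N).card + (countingFn B (2 * N) + 1) * Nat.sqrt N := by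
  classical
  have h1 : Finset.Icc N (2 * N) ⊆ isolatedIntegers B N ∪
      (initialSegment B (2 * N)).biUnion fun b => Finset.Ico b (b + Nat.sqrt N) := by
    intro n hn
    rw [Finset.mem_union, or_iff_not_imp_left]
    intro hnot
    simp only [isolatedIntegers, Finset.mem_filter, hn, true_and, not_forall, not_le] at hnot
    obtain ⟨m, hm, hlt⟩ := hnot
    obtain ⟨b, hb, hbn, rfl⟩ := mem_differences.1 hm
    have := (Finset.mem_Icc.1 hn).2
    exact Finset.mem_biUnion.2 ⟨b, mem_initialSegment.2 ⟨by lia, hb⟩,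
      Finset.mem_Ico.2 ⟨hbn, by lia⟩⟩
  have h2 := (Finset.card_le_card h1).trans (Finset.card_union_le _ _)
  have h3 : ((initialSegment B (2 * N)).biUnion fun b => Finset.Ico b (b + Nat.sqrt N)).card ≤
      (countingFn B (2 * N) + 1) * Nat.sqrt N :=
    (Finset.card_biUnion_le_card_mul _ _ (Nat.sqrt N) fun b _ => by simp).trans
      (Nat.mul_le_mul_right _ (card_initialSegment_le B _))
  rw [Nat.card_Icc] at h2
  lia

/-- A common difference `n - b = n' - b'` determines `n'` from the pair `(b, b')`. -/
theorem card_filter_not_disjoint_differences_le (B : Set ℕ) (N n : ℕ) (hn : n ≤ 2 * N) :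
    ((isolatedIntegers B N).filter fun n' =>
      ¬ Disjoint (differences B n) (differences B n')).card ≤ (countingFn B (2 * N) + 1) ^ 2 := by
  have h1 : ((isolatedIntegers B N).filter fun n' =>
      ¬ Disjoint (differences B n) (differences B n')) ⊆
      (initialSegment B (2 * N) ×ˢ initialSegment B (2 * N)).image
        fun x : ℕ × ℕ => n - x.1 + x.2 := by
    intro n' h
    simp only [isolatedIntegers, Finset.mem_filter, Finset.mem_Icc] at h
    obtain ⟨m, hm, hm'⟩ := Finset.not_disjoint_iff.1 h.2
    obtain ⟨b, hb, hbn, e⟩ := mem_differences.1 hm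
    obtain ⟨b', hb', hbn', e'⟩ := mem_differences.1 hm'
    have := h.1.1.2
    refine Finset.mem_image.2 ⟨(b, b'), Finset.mem_product.2 ⟨mem_initialSegment.2 ⟨?_, hb⟩,
      mem_initialSegment.2 ⟨?_, hb'⟩⟩, ?_⟩ <;> simp only <;> lia
  refine (Finset.card_le_card h1).trans (Finset.card_image_le.trans ?_)
  rw [Finset.card_product, ← sq]
  exact Nat.pow_le_pow_left (card_initialSegment_le B _) 2

variable [MeasurableSpace Ω] {P : Measure Ω} [IsProbabilityMeasure P]

/-- If sets of targets rarely intersect, then most likely at least one of them is avoided. -/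
theorem IsPseudoPowers.exists_measureReal_biInter_compl_le {s : ℕ} (hs : 2 ≤ s)
    (hA : IsPseudoPowers s P A) : ∃ C, 0 ≤ C ∧ ∀ (L k : ℕ) (T : Finset ℕ) (M : ℕ → Finset ℕ),
      (∀ n ∈ T, ∀ m ∈ M n, L ≤ m) → (∀ n ∈ T, (M n).card ≤ k) →
      (∀ n ∈ T, (T.filter fun n' => ¬ Disjoint (M n) (M n')).card ≤ k ^ 2) →
      (∀ n ∈ T, Real.exp (-(lambdaConst s * (M n).card) -
        C * (k : ℝ) ^ 2 * ((L : ℝ) + 1) ^ (-(1 / (s : ℝ) / 2))) ≤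
          P.real (avoidEvent A (repFamily s (M n)))) ∧
      ∀ q : ℝ, 0 < q → q ≤ ∑ n ∈ T, P.real (avoidEvent A (repFamily s (M n))) →
      P.real (⋂ n ∈ T, (avoidEvent A (repFamily s (M n)))ᶜ) ≤
        (Real.exp (3 * (C * (k : ℝ) ^ 2 * ((L : ℝ) + 1) ^ (-(1 / (s : ℝ) / 2)))) - 1) +
          (k : ℝ) ^ 2 / q := by
  obtain ⟨C, hC, H⟩ := hA.exists_measureReal_avoidEvent_bounds hs
  -- The bounds are also applied to unions `M n ∪ M n'`, of size up to `2k`, hence the factor `4`.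
  refine ⟨4 * C, by positivity, fun L k T M hL hk hbad => ?_⟩
  set r := ((L : ℝ) + 1) ^ (-(1 / (s : ℝ) / 2)) with hr
  have hr0 : 0 < r := by positivity
  set e := 4 * C * (k : ℝ) ^ 2 * r with he
  have hmono : ∀ x : ℝ, 0 ≤ x → x ≤ 2 * k → C * x ^ 2 * r ≤ e := by
    intro x h0 h1
    have := pow_le_pow_left₀ h0 h1 2
    calc C * x ^ 2 * r ≤ C * (2 * k) ^ 2 * r := by gcongr
      _ = e := by
        rw [he]
        ring
  have hk' : ∀ n ∈ T, ((M n).card : ℝ) ≤ k := fun n hn => by exact_mod_cast hk n hn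
  have hk0 : (0 : ℝ) ≤ k := Nat.cast_nonneg k
  set E : ℕ → Set Ω := fun n => avoidEvent A (repFamily s (M n)) with hE
  have hlow : ∀ n ∈ T, Real.exp (-(lambdaConst s * (M n).card) - e) ≤ P.real (E n) := by
    intro n hn
    refine (Real.exp_le_exp.2 ?_).trans (H L (M n) (hL n hn)).1
    have := hmono _ (Nat.cast_nonneg (M n).card) (by linarith [hk' n hn])
    linarith
  refine ⟨hlow, fun q hq hqT => ?_⟩
  set m := ∑ n ∈ T, P.real (E n) with hm
  have hm0 : 0 < m := hq.trans_le hqT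
  -- For disjoint target sets the main exponents add up exactly. The factor `exp (3 * e)` collects
  -- one error from the upper bound for the union and two from the lower bounds. Other pairs are
  -- bounded trivially.
  have hpair : ∀ n ∈ T, ∀ n' ∈ T, P.real (E n ∩ E n') ≤
      Real.exp (3 * e) * (P.real (E n) * P.real (E n')) +
        if ¬ Disjoint (M n) (M n') then P.real (E n) else 0 := by
    intro n hn n' hn'
    split_ifs with hdis
    · rw [add_zero]
      have hcard : ((M n ∪ M n').card : ℝ) = (M n).card + (M n').card := by
        exact_mod_cast Finset.card_union_of_disjoint hdis
      have h1 := (H L (M n ∪ M n') fun m hm =>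
        (Finset.mem_union.1 hm).elim (hL n hn m) (hL n' hn' m)).2
      rw [repFamily_union, avoidEvent_union, hcard] at h1
      refine h1.trans (le_trans ?_ (mul_le_mul_of_nonneg_left (mul_le_mul (hlow n hn)
        (hlow n' hn') (Real.exp_pos _).le measureReal_nonneg) (Real.exp_pos _).le))
      rw [← Real.exp_add, ← Real.exp_add]
      refine Real.exp_le_exp.2 ?_
      have := hmono ((M n).card + (M n').card) (by positivity) (by linarith [hk' n hn, hk' n' hn'])
      linarith
    · exact (measureReal_mono Set.inter_subset_left).trans
        (le_add_of_nonneg_left (by positivity))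
  have hsum : ∑ n ∈ T, ∑ n' ∈ T, P.real (E n ∩ E n') ≤
      Real.exp (3 * e) * m ^ 2 + (k : ℝ) ^ 2 * m := by
    calc _ ≤ ∑ n ∈ T, ∑ n' ∈ T, (Real.exp (3 * e) * (P.real (E n) * P.real (E n')) +
          if ¬ Disjoint (M n) (M n') then P.real (E n) else 0) :=
          Finset.sum_le_sum fun n hn => Finset.sum_le_sum fun n' hn' => hpair n hn n' hn'
      _ = Real.exp (3 * e) * m ^ 2 + ∑ n ∈ T,
          ((T.filter fun n' => ¬ Disjoint (M n) (M n')).card : ℝ) * P.real (E n) := by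
          simp only [Finset.sum_add_distrib, ← Finset.mul_sum, ← Finset.sum_filter,
            Finset.sum_const, nsmul_eq_mul]
          rw [← Finset.sum_mul, ← hm, sq]
      _ ≤ _ := by
          rw [hm, Finset.mul_sum]
          refine add_le_add le_rfl (Finset.sum_le_sum fun n hn => ?_)
          exact mul_le_mul_of_nonneg_right (by exact_mod_cast hbad n hn) measureReal_nonneg
  have hcheb := measureReal_biInter_compl_mul_sq_le (P := P) T E
    fun n => measurableSet_avoidEvent hA.measurableSet_mem _
  have hfin : P.real (⋂ n ∈ T, (E n)ᶜ) ≤ (Real.exp (3 * e) - 1) + (k : ℝ) ^ 2 / m := by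
    have h1 : P.real (⋂ n ∈ T, (E n)ᶜ) * m ^ 2 ≤
        ((Real.exp (3 * e) - 1) + (k : ℝ) ^ 2 / m) * m ^ 2 := by
      have e1 : (k : ℝ) ^ 2 / m * m ^ 2 = (k : ℝ) ^ 2 * m := by
        field_simp
      rw [add_mul, e1]
      linarith
    exact le_of_mul_le_mul_right h1 (by positivity)
  refine hfin.trans (add_le_add le_rfl ?_)
  gcongr

theorem IsPseudoPowers.almostSurelyNotComplement {s : ℕ} (hs : 2 ≤ s)
    (hA : IsPseudoPowers s P A) {t : ℕ → ℝ} (ht : t =o[atTop] fun n : ℕ => Real.log n)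
    (ht' : (fun n : ℕ => Real.log n ^ 3) =O[atTop] fun n : ℕ => Real.exp (lambdaConst s * t n))
    {B : Set ℕ} (hB : HasCountingFn B fun n => (lambdaConst s)⁻¹ * Real.log n - t n) :
    AlmostSurelyNotComplement s P A B := by
  obtain ⟨C, hC, H⟩ := hA.exists_measureReal_biInter_compl_le hs
  have hlam := lambdaConst_pos hs
  obtain ⟨h0, -, -⟩ := inv_natCast_bounds hs
  set lam := lambdaConst s with hlam_def
  set d := 1 / (s : ℝ) / 2 with hd
  have hd0 : 0 < d := by positivity
  have hlim := hB.tendsto_div_log (c := lam⁻¹) ht.neg_left fun n => sub_eq_add_neg _ _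
  have hlog := tendsto_log_natCast
  obtain ⟨c, hc, hc'⟩ := ht'.exists_pos
  -- Eventually `B(2N) ≤ 2 λ_s⁻¹ log (2N) ≤ 4 λ_s⁻¹ log N`, and the extra `1` is at most `log N`.
  set D := 4 * lam⁻¹ + 1 with hD
  have hD0 : 0 < D := by positivity
  have hk : ∀ᶠ N : ℕ in atTop, ((countingFn B (2 * N) + 1 : ℕ) : ℝ) ≤ D * Real.log N := by
    have h2 : Tendsto (fun N : ℕ => 2 * N) atTop atTop :=
      tendsto_id.const_mul_atTop' two_pos
    filter_upwards [h2.eventually (eventually_countingFn_le (inv_pos.2 hlam) hlim),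
      hlog.eventually_ge_atTop 1, eventually_ge_atTop 2] with N h3 h4 h5
    have h6 : Real.log (2 * N : ℕ) ≤ 2 * Real.log N := by
      rw [two_mul (Real.log N), ← Real.log_mul (by positivity) (by positivity)]
      refine Real.log_le_log (by positivity) ?_
      exact_mod_cast Nat.mul_le_mul_right N h5
    have h7 := mul_le_mul_of_nonneg_left h6 (by positivity : 0 ≤ 2 * lam⁻¹)
    push_cast at h3 h7 ⊢
    rw [hD]
    linarith
  have herr : ∀ᶠ N : ℕ in atTop, C * ((countingFn B (2 * N) + 1 : ℕ) : ℝ) ^ 2 *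
      ((Nat.sqrt N : ℝ) + 1) ^ (-d) ≤
        C * D ^ 2 * (Real.log N ^ 2 * (N : ℝ) ^ (-(d / 2))) := by
    filter_upwards [hk, eventually_gt_atTop 0] with N h1 h2
    have h2' : (0 : ℝ) < N := by exact_mod_cast h2
    have h3 : ((Nat.sqrt N : ℝ) + 1) ^ (-d) ≤ (N : ℝ) ^ (-(d / 2)) := by
      have := Real.rpow_le_rpow_of_nonpos (Real.sqrt_pos.2 h2')
        (Real.real_sqrt_le_nat_sqrt_succ (a := N)) (neg_nonpos.2 hd0.le)
      refine this.trans_eq ?_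
      rw [Real.sqrt_eq_rpow, ← Real.rpow_mul h2'.le]
      ring_nf
    have h4 := pow_le_pow_left₀ (Nat.cast_nonneg _) h1 2
    calc _ ≤ C * (D * Real.log N) ^ 2 * (N : ℝ) ^ (-(d / 2)) := by gcongr
      _ = _ := by ring
  have herr0 : Tendsto (fun N : ℕ => C * D ^ 2 * (Real.log N ^ 2 * (N : ℝ) ^ (-(d / 2))))
      atTop (nhds 0) := by
    simpa using (tendsto_log_sq_mul_rpow_neg (half_pos hd0)).const_mul (C * D ^ 2)
  have hT : ∀ᶠ N : ℕ in atTop, (N : ℝ) / 2 ≤ (isolatedIntegers B N).card := by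
    have h1 := ((isLittleO_log_rpow_atTop (r := 1 / 2) (by norm_num)).comp_tendsto
      (tendsto_natCast_atTop_atTop (R := ℝ))).bound (by positivity : 0 < (2 * D)⁻¹)
    filter_upwards [h1, hk, hlog.eventually_gt_atTop 0] with N h2 h3 h4
    simp only [Function.comp, ← Real.sqrt_eq_rpow, Real.norm_eq_abs] at h2
    rw [abs_of_pos h4, abs_of_nonneg (Real.sqrt_nonneg _)] at h2
    have h5 : (N : ℝ) < (isolatedIntegers B N).card +
        ((countingFn B (2 * N) + 1 : ℕ) : ℝ) * Nat.sqrt N := by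
      exact_mod_cast lt_card_isolatedIntegers_add B N
    have h6 : ((countingFn B (2 * N) + 1 : ℕ) : ℝ) * Nat.sqrt N ≤ N / 2 := by
      calc _ ≤ D * ((2 * D)⁻¹ * Real.sqrt N) * Real.sqrt N := by
            gcongr
            · exact h3.trans (mul_le_mul_of_nonneg_left h2 hD0.le)
            · exact Real.nat_sqrt_le_real_sqrt
        _ = (D * (2 * D)⁻¹) * (Real.sqrt N * Real.sqrt N) := by ring
        _ = N / 2 := by
            rw [Real.mul_self_sqrt (Nat.cast_nonneg N)]
            field_simp
    linarith
  -- `lam` pays for a possible `0 ∈ B`, `1` for the error in the exponent, `c` is the implied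
  -- constant for `log³`. The `4` comes from `n ≤ 2N` and from having at least `N/2` isolated
  -- integers.
  set c₁ := Real.exp (-(lam + 1)) * c⁻¹ / 4 with hc₁
  have hc₁0 : 0 < c₁ := by positivity
  have hbound : ∀ᶠ N : ℕ in atTop,
      P.real (⋂ n ∈ isolatedIntegers B N, (avoidEvent A (repFamily s (differences B n)))ᶜ) ≤
        (Real.exp (3 * (C * D ^ 2 * (Real.log N ^ 2 * (N : ℝ) ^ (-(d / 2))))) - 1) +
          D ^ 2 / c₁ * (Real.log N)⁻¹ := by
    obtain ⟨N₀, hN₀⟩ := eventually_atTop.1 (hB.and hc'.bound)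
    filter_upwards [hk, herr, herr0.eventually_le_const one_pos, hT,
      hlog.eventually_gt_atTop 0, eventually_ge_atTop N₀, eventually_gt_atTop 0]
      with N h1 h2 h3 h4 h5 h6 h7
    have h7' : (0 : ℝ) < N := by exact_mod_cast h7
    have hIcc : ∀ n ∈ isolatedIntegers B N, N ≤ n ∧ n ≤ 2 * N := fun n hn =>
      Finset.mem_Icc.1 (Finset.mem_filter.1 hn).1
    obtain ⟨Hlow, Hup⟩ := H (Nat.sqrt N) (countingFn B (2 * N) + 1) (isolatedIntegers B N)
      (differences B) (fun n hn => (Finset.mem_filter.1 hn).2)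
      (fun n hn => (card_differences_le B n).trans
        (Nat.succ_le_succ (countingFn_mono B (hIcc n hn).2)))
      (fun n hn => card_filter_not_disjoint_differences_le B N n (hIcc n hn).2)
    have hP : ∀ n ∈ isolatedIntegers B N, 2 * c₁ * (Real.log N ^ 3 / N) ≤
        P.real (avoidEvent A (repFamily s (differences B n))) := by
      intro n hn
      obtain ⟨hn1, hn2⟩ := hIcc n hn
      obtain ⟨hB', hO⟩ := hN₀ n (h6.trans hn1)
      have hn0 : (0 : ℝ) < n := h7'.trans_le (by exact_mod_cast hn1)
      have hlogn : Real.log N ≤ Real.log n := Real.log_le_log h7' (by exact_mod_cast hn1)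
      refine le_trans ?_ (Hlow n hn)
      have hcard : ((differences B n).card : ℝ) ≤ lam⁻¹ * Real.log n - t n + 1 := by
        have e1 : ((differences B n).card : ℝ) ≤ countingFn B n + 1 := by
          exact_mod_cast card_differences_le B n
        have e2 : (countingFn B n : ℝ) = ⌊lam⁻¹ * Real.log n - t n⌋ := by exact_mod_cast hB'
        have e3 := Int.floor_le (lam⁻¹ * Real.log n - t n)
        linarith
      have hmul : lam * (differences B n).card ≤ Real.log n - lam * t n + lam := by
        refine (mul_le_mul_of_nonneg_left hcard hlam.le).trans_eq ?_
        field_simp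
      rw [Real.norm_eq_abs, Real.norm_eq_abs, Real.abs_exp, abs_of_nonneg
        (pow_nonneg (h5.le.trans hlogn) 3)] at hO
      have hO' : c⁻¹ * Real.log N ^ 3 ≤ Real.exp (lam * t n) := by
        rw [inv_mul_le_iff₀ hc]
        exact (pow_le_pow_left₀ h5.le hlogn 3).trans hO
      calc 2 * c₁ * (Real.log N ^ 3 / N)
          = Real.exp (-(lam + 1)) * ((2 * (N : ℝ))⁻¹ * (c⁻¹ * Real.log N ^ 3)) := by
            rw [hc₁]
            field_simp
            ring
        _ ≤ Real.exp (-(lam + 1)) * ((n : ℝ)⁻¹ * Real.exp (lam * t n)) := by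
            gcongr
            exact_mod_cast hn2
        _ = Real.exp (-(lam + 1) + (-Real.log n + lam * t n)) := by
            rw [Real.exp_add, Real.exp_add, Real.exp_neg (Real.log n), Real.exp_log hn0]
        _ ≤ _ := by
            refine Real.exp_le_exp.2 ?_
            linarith
    have hq : c₁ * Real.log N ^ 3 ≤
        ∑ n ∈ isolatedIntegers B N, P.real (avoidEvent A (repFamily s (differences B n))) := by
      calc c₁ * Real.log N ^ 3 = (N / 2 : ℝ) * (2 * c₁ * (Real.log N ^ 3 / N)) := by
            field_simp
        _ ≤ (isolatedIntegers B N).card * (2 * c₁ * (Real.log N ^ 3 / N)) := by gcongr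
        _ ≤ _ := by
            rw [← nsmul_eq_mul]
            exact Finset.card_nsmul_le_sum _ _ _ hP
    refine (Hup _ (by positivity) hq).trans (add_le_add ?_ ?_)
    · refine sub_le_sub_right (Real.exp_le_exp.2 ?_) 1
      linarith
    -- The cube in the hypothesis on `t` is what beats the `log² N` dependent partners of each `n`.
    · calc _ ≤ (D * Real.log N) ^ 2 / (c₁ * Real.log N ^ 3) := by gcongr
        _ = _ := by field_simp
  have hbound0 : Tendsto (fun N : ℕ =>
      (Real.exp (3 * (C * D ^ 2 * (Real.log N ^ 2 * (N : ℝ) ^ (-(d / 2))))) - 1) +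
          D ^ 2 / c₁ * (Real.log N)⁻¹) atTop (nhds 0) := by
    have h1 := (Real.continuous_exp.tendsto _).comp (herr0.const_mul 3)
    have h2 := (h1.sub_const 1).add (hlog.inv_tendsto_atTop.const_mul (D ^ 2 / c₁))
    simpa using h2
  -- Representability of all `n ≥ K` is contained in the no-failure event for every `N ≥ K`, whose
  -- probability tends to `0`; no zero-one law is needed.
  have hnull : ∀ K : ℕ, ∀ᵐ ω ∂P, ∃ n ≥ K, ¬ IsRepresentable s (A ω) B n := by
    intro K
    rw [ae_iff, ← measureReal_eq_zero_iff]
    refine le_antisymm (ge_of_tendsto hbound0 ?_) measureReal_nonneg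
    filter_upwards [hbound, eventually_ge_atTop K] with N h1 h2
    refine (measureReal_mono fun ω hω => ?_).trans h1
    simp only [Set.mem_iInter, Set.mem_compl_iff, mem_avoidEvent_differences_iff]
    intro n hn hrep
    have hn' := (Finset.mem_Icc.1 (Finset.mem_filter.1 hn).1).1
    exact hω ⟨n, h2.trans hn', hrep⟩
  filter_upwards [ae_all_iff.2 hnull] with ω hω
  exact Nat.frequently_atTop_iff_infinite.1 (frequently_atTop.2 hω)

end NotComplement

/-! ### The theorem -/

theorem mainTheorem4 (s : ℕ) (hs : 2 ≤ s) {Ω : Type*} [MeasurableSpace Ω]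
    (P : Measure Ω) [IsProbabilityMeasure P] (A : Ω → Set ℕ) (hA : IsPseudoPowers s P A) :
    -- the first example: such `B` exist, are at the threshold, and are almost surely complements
    ((∃ B : Set ℕ, HasCountingFn B (fun n => (lambdaConst s)⁻¹ * Real.log n
          + 2 * (lambdaConst s)⁻¹ * Real.log (Real.log n))) ∧
      ∀ B : Set ℕ, HasCountingFn B (fun n => (lambdaConst s)⁻¹ * Real.log n
          + 2 * (lambdaConst s)⁻¹ * Real.log (Real.log n)) →
        AtThreshold s B ∧ AlmostSurelyComplement s P A B) ∧
    -- every admissible `t`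
    (∀ t : ℕ → ℝ, (t =o[atTop] fun n : ℕ => Real.log n) →
      ((fun n : ℕ => Real.log n ^ 3) =O[atTop] fun n : ℕ => Real.exp (lambdaConst s * t n)) →
      ∀ B : Set ℕ, HasCountingFn B (fun n => (lambdaConst s)⁻¹ * Real.log n - t n) →
        AtThreshold s B ∧ AlmostSurelyNotComplement s P A B) ∧
    -- the second example, `t(n) = 4 λ_s⁻¹ log log n`
    ((∃ B : Set ℕ, HasCountingFn B (fun n => (lambdaConst s)⁻¹ * Real.log n
          - 4 * (lambdaConst s)⁻¹ * Real.log (Real.log n))) ∧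
      ∀ B : Set ℕ, HasCountingFn B (fun n => (lambdaConst s)⁻¹ * Real.log n
          - 4 * (lambdaConst s)⁻¹ * Real.log (Real.log n)) →
        AtThreshold s B ∧ AlmostSurelyNotComplement s P A B) := by
  have hlam := lambdaConst_pos hs
  have h2 : ∀ t : ℕ → ℝ, (t =o[atTop] fun n : ℕ => Real.log n) →
      ((fun n : ℕ => Real.log n ^ 3) =O[atTop] fun n : ℕ => Real.exp (lambdaConst s * t n)) →
      ∀ B : Set ℕ, HasCountingFn B (fun n => (lambdaConst s)⁻¹ * Real.log n - t n) →
        AtThreshold s B ∧ AlmostSurelyNotComplement s P A B := fun t ht ht' B hB =>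
    ⟨atThreshold_of_tendsto (hB.tendsto_div_log ht.neg_left fun n => sub_eq_add_neg _ _),
      hA.almostSurelyNotComplement hs ht ht' hB⟩
  refine ⟨⟨exists_hasCountingFn_log_add_log_log (inv_pos.2 hlam) _, fun B hB =>
    ⟨atThreshold_of_tendsto (hB.tendsto_div_log (isLittleO_log_log.const_mul_left _)
      fun n => rfl), hA.almostSurelyComplement hs hB⟩⟩, h2, ?_,
    h2 _ (isLittleO_log_log.const_mul_left _) ?_⟩
  · simpa only [sub_eq_add_neg, neg_mul] using
      exists_hasCountingFn_log_add_log_log (inv_pos.2 hlam) (-(4 * (lambdaConst s)⁻¹))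
  -- Here `exp (λ_s t(n)) = log⁴ n`, which dominates `log³ n` as soon as `log n ≥ 1`.
  · refine IsBigO.of_bound 1 ?_
    filter_upwards [tendsto_log_natCast.eventually_ge_atTop 1] with n hn
    have h0 : 0 < Real.log n := by linarith
    have e : lambdaConst s * (4 * (lambdaConst s)⁻¹ * Real.log (Real.log n)) =
        4 * Real.log (Real.log n) := by
      field_simp
    have e4 : Real.exp (4 * Real.log (Real.log n)) = Real.log n ^ 4 := by
      rw [show (4 : ℝ) * Real.log (Real.log n) = ((4 : ℕ) : ℝ) * Real.log (Real.log n) by norm_num,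
        Real.exp_nat_mul, Real.exp_log h0]
    rw [e, e4, one_mul, Real.norm_of_nonneg (by positivity), Real.norm_of_nonneg (by positivity)]
    exact pow_le_pow_right₀ hn (by norm_num)
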